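/- Let $n$ and $k$ be integers with $1\le k\le n$. For $\lambda\in\mathbb R^n$ let $\sigma_j(\lambda)$ denote the $j$-th elementary symmetric function of $\lambda_1,\dots,\lambda_n$, let $\Gamma_k=\{\lambda\in\mathbb R^n:\sigma_j(\lambda)>0 \text{ for } j=1,\dots,k\}$, and write $\sigma_k^{ii}=\partial\sigma_k/\partial\lambda_i$ and $\sigma_k^{pp,qq}=\partial^2\sigma_k/\partial\lambda_p\partial\lambda_q$. Put $\gamma=1/(1+16k)$. Then there is a constant $\delta_0\in(0,1)$ depending only on $n$ and $k$, and for every $s>0$ a constant $\Lambda>0$ depending only on $n$, $k$ and $s$, such that the following holds. If $0<\delta\le\delta_0$ and $\lambda\in\Gamma_k$ satisfies $$\lambda_1\ge\lambda_2\ge\dots\ge\lambda_n,\qquad \sigma_k(\lambda)=s,\qquad \lambda_n\ge-\delta\lambda_1,\qquad \lambda_1\ge\Lambda,$$ then for every $\xi=(\xi_1,\dots,\xi_n)\in\mathbb R^n$, with all functions evaluated at $\lambda$, $$-\sum_{p\ne q}\frac{\sigma_k^{pp,qq}\,\xi_p\xi_q}{\sigma_k}+2\,\frac{\bigl(\sum_{i}\sigma_k^{ii}\xi_i\bigr)^2}{\sigma_k^2}+2\sum_{i>1}\frac{\sigma_k^{ii}\,\xi_i^2}{(1+2\delta)\lambda_1\sigma_k}\;\ge\;(1+\gamma)\,\frac{\sigma_k^{11}\,\xi_1^2}{\lambda_1\sigma_k}.$$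 -/

import Mathlib

noncomputable section

/-- The `k`-th elementary symmetric function `σ_k` on `ℝⁿ`, evaluated at `lam`. -/
def sigma (n k : ℕ) (lam : Fin n → ℝ) : ℝ :=
  MvPolynomial.eval lam (MvPolynomial.esymm (Fin n) ℝ k)

/-- `σ_k^{ii}`: the partial derivative `∂σ_k/∂λ_i`, evaluated at `lam`. -/
def sigmaD (n k : ℕ) (i : Fin n) (lam : Fin n → ℝ) : ℝ :=
  MvPolynomial.eval lam (MvPolynomial.pderiv i (MvPolynomial.esymm (Fin n) ℝ k))

/-- `σ_k^{pp,qq}`: the second partial derivative `∂²σ_k/∂λ_p∂λ_q`, evaluated at `lam`. -/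
def sigmaDD (n k : ℕ) (p q : Fin n) (lam : Fin n → ℝ) : ℝ :=
  MvPolynomial.eval lam
    (MvPolynomial.pderiv p (MvPolynomial.pderiv q (MvPolynomial.esymm (Fin n) ℝ k)))

/-- The Gårding cone `Γ_k` in `ℝⁿ`: all of `σ_1, …, σ_k` are positive. -/
def gardingCone (n k : ℕ) : Set (Fin n → ℝ) :=
  {lam | ∀ j : ℕ, 1 ≤ j → j ≤ k → 0 < sigma n j lam}

end

/-! Write σ_k = A·(λ_1 + q) with A = σ_{k-1}(λ|1) and q = σ_k(λ|1)/σ_{k-1}(λ|1), and let primes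
denote derivatives along ξ. Concavity of A^{1/(k-1)} bounds the first two terms on the left below by
(1+1/k)((ξ_1+q')/(λ_1+q))² − q''/(λ_1+q) (`InCone.second_order_ge`), and q'' ≤ 0.

What remains is to control q'. The key estimate is (q')² ≤ X·(−q'' + (3/4)T), where T is a weighted
sum of ξ_j² over the small entries, absorbed by the third term (`InCone.sum_sq_le`), and X = c(−q) +
E with 1/2 ≤ c ≤ 7/8 and E small against λ_1. Splitting ξ_1 = (ξ_1+q') − q' by Cauchy–Schwarz then
reduces the claim to (1+γ)((λ_1+q)k/(k+1) + X) ≤ λ_1 (`final_coefficient_le`).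

The key estimate (`exists_quotD_sq_le`) is an induction on the number l of large entries. By Euler's
identity kq is the sum of the harmonic combinations x_i p_i/(x_i+p_i), with p_i the quotient one
degree lower and x_i deleted. A large i is handled by induction on p_i, a small i directly through
ξ_i. The l large indices use T once each and the small ones together at most k − l times, which is
exactly the factor k available. As l ≤ k − 2, the share of the small ones is about 2 or more, hence
c ≤ 7/8.

A gap between large and small entries comes from thresholds 1 = Θ_0 ≥ Θ_1 ≥ …, each chosen small in
terms of the previous one. Since σ_k = s while λ_1 is huge, λ_k < Θ_{k-1}λ_1, so a gap occurs among
the first k entries. -/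

/-- The elementary symmetric function of degree `j` in the variables `x i`, `i ∈ S`. -/
def esymmOn {ι R : Type*} [CommRing R] (x : ι → R) (S : Finset ι) (j : ℕ) : R :=
  ∑ T ∈ S.powersetCard j, ∏ i ∈ T, x i

@[simp] theorem esymmOn_zero {ι R : Type*} [CommRing R] (x : ι → R) (S : Finset ι) :
    esymmOn x S 0 = 1 := by
  simp [esymmOn]

@[simp] theorem esymmOn_empty_succ {ι R : Type*} [CommRing R] (x : ι → R) (j : ℕ) :
    esymmOn x ∅ (j + 1) = 0 := by
  rw [esymmOn, Finset.powersetCard_eq_empty.2 (by simp), Finset.sum_empty]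

/-! ### Deletion recurrences and Euler identities, with two derivatives. -/

section Recurrences

variable {ι R : Type*} [DecidableEq ι] [CommRing R]

theorem esymmOn_insert (x : ι → R) {S : Finset ι} {i : ι} (hi : i ∉ S) (j : ℕ) :
    esymmOn x (insert i S) (j + 1) = x i * esymmOn x S j + esymmOn x S (j + 1) := by
  unfold esymmOn
  rw [Finset.powersetCard_succ_insert hi, Finset.sum_union, Finset.sum_image, add_comm,
    Finset.mul_sum]
  · congr 1
    refine Finset.sum_congr rfl fun T hT => ?_
    rw [Finset.prod_insert]
    exact fun h => hi ((Finset.mem_powersetCard.1 hT).1 h)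
  · intro T hT U hU h
    have hT' : i ∉ T := fun h' => hi ((Finset.mem_powersetCard.1 hT).1 h')
    have hU' : i ∉ U := fun h' => hi ((Finset.mem_powersetCard.1 hU).1 h')
    rw [← Finset.erase_insert hT', h, Finset.erase_insert hU']
  · rw [Finset.disjoint_left]
    intro T hT hT'
    obtain ⟨U, -, rfl⟩ := Finset.mem_image.1 hT'
    exact hi ((Finset.mem_powersetCard.1 hT).1 (Finset.mem_insert_self i U))

theorem esymmOn_succ (x : ι → R) {S : Finset ι} {i : ι} (hi : i ∈ S) (j : ℕ) :
    esymmOn x S (j + 1) = x i * esymmOn x (S.erase i) j + esymmOn x (S.erase i) (j + 1) := by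
  conv_lhs => rw [← Finset.insert_erase hi]
  exact esymmOn_insert x (Finset.notMem_erase i S) j

/-- The derivative of `esymmOn x S j` in the direction `ξ`. -/
def esymmOnD (x ξ : ι → R) (S : Finset ι) : ℕ → R
  | 0 => 0
  | j + 1 => ∑ i ∈ S, ξ i * esymmOn x (S.erase i) j

/-- The second derivative of `esymmOn x S j` in the direction `ξ`. -/
def esymmOnDD (x ξ : ι → R) (S : Finset ι) : ℕ → R
  | 0 => 0
  | j + 1 => ∑ i ∈ S, ξ i * esymmOnD x ξ (S.erase i) j

@[simp] theorem esymmOnD_zero (x ξ : ι → R) (S : Finset ι) : esymmOnD x ξ S 0 = 0 := rfl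

@[simp] theorem esymmOnDD_zero (x ξ : ι → R) (S : Finset ι) : esymmOnDD x ξ S 0 = 0 := rfl

theorem esymmOnD_succ' (x ξ : ι → R) (S : Finset ι) (j : ℕ) :
    esymmOnD x ξ S (j + 1) = ∑ i ∈ S, ξ i * esymmOn x (S.erase i) j := rfl

theorem esymmOnDD_succ' (x ξ : ι → R) (S : Finset ι) (j : ℕ) :
    esymmOnDD x ξ S (j + 1) = ∑ i ∈ S, ξ i * esymmOnD x ξ (S.erase i) j := rfl

theorem esymmOnD_succ (x ξ : ι → R) {S : Finset ι} {i : ι} (hi : i ∈ S) (j : ℕ) :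
    esymmOnD x ξ S (j + 1) = ξ i * esymmOn x (S.erase i) j + x i * esymmOnD x ξ (S.erase i) j
      + esymmOnD x ξ (S.erase i) (j + 1) := by
  rw [esymmOnD_succ', esymmOnD_succ', ← Finset.add_sum_erase S _ hi, add_assoc]
  congr 1
  cases j with
  | zero => simp
  | succ j =>
    rw [esymmOnD_succ', Finset.mul_sum, ← Finset.sum_add_distrib]
    refine Finset.sum_congr rfl fun p hp => ?_
    have hip : i ∈ S.erase p := Finset.mem_erase.2 ⟨(Finset.ne_of_mem_erase hp).symm, hi⟩
    rw [esymmOn_succ x hip, Finset.erase_right_comm]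
    ring

theorem esymmOnDD_succ (x ξ : ι → R) {S : Finset ι} {i : ι} (hi : i ∈ S) (j : ℕ) :
    esymmOnDD x ξ S (j + 1) = 2 * ξ i * esymmOnD x ξ (S.erase i) j
      + x i * esymmOnDD x ξ (S.erase i) j + esymmOnDD x ξ (S.erase i) (j + 1) := by
  rw [esymmOnDD_succ', esymmOnDD_succ', ← Finset.add_sum_erase S _ hi]
  cases j with
  | zero => simp
  | succ j =>
    rw [esymmOnDD_succ', Finset.mul_sum]
    have h : ∑ p ∈ S.erase i, ξ p * esymmOnD x ξ (S.erase p) (j + 1)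
        = ξ i * esymmOnD x ξ (S.erase i) (j + 1)
          + ∑ p ∈ S.erase i, (x i * (ξ p * esymmOnD x ξ ((S.erase i).erase p) j)
            + ξ p * esymmOnD x ξ ((S.erase i).erase p) (j + 1)) := by
      rw [esymmOnD_succ', Finset.mul_sum, ← Finset.sum_add_distrib]
      refine Finset.sum_congr rfl fun p hp => ?_
      have hip : i ∈ S.erase p := Finset.mem_erase.2 ⟨(Finset.ne_of_mem_erase hp).symm, hi⟩
      rw [esymmOnD_succ x ξ hip, Finset.erase_right_comm]
      ring
    rw [h, Finset.sum_add_distrib]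
    ring

/-- Homogeneity: a monomial of degree j + 1 is counted once for each of its variables. The next two
identities are its directional derivatives. -/
theorem esymmOn_euler (x : ι → R) (S : Finset ι) (j : ℕ) :
    ((j : R) + 1) * esymmOn x S (j + 1) = ∑ i ∈ S, x i * esymmOn x (S.erase i) j := by
  induction S using Finset.induction_on generalizing j with
  | empty => simp
  | insert p S hp ih =>
    rw [Finset.sum_insert hp, Finset.erase_insert hp, esymmOn_insert x hp]
    have hne : ∀ i ∈ S, p ∈ (insert p S).erase i := fun i hi =>
      Finset.mem_erase.2 ⟨fun h => hp (h ▸ hi), Finset.mem_insert_self p S⟩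
    have her : ∀ i, ((insert p S).erase i).erase p = S.erase i := fun i => by
      rw [Finset.erase_right_comm, Finset.erase_insert hp]
    cases j with
    | zero =>
      have := ih 0
      simp at this ⊢
      rw [this]
    | succ j =>
      have h : ∑ i ∈ S, x i * esymmOn x ((insert p S).erase i) (j + 1)
          = x p * ∑ i ∈ S, x i * esymmOn x (S.erase i) j
            + ∑ i ∈ S, x i * esymmOn x (S.erase i) (j + 1) := by
        rw [Finset.mul_sum, ← Finset.sum_add_distrib]
        refine Finset.sum_congr rfl fun i hi => ?_
        rw [esymmOn_succ x (hne i hi), her]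
        ring
      rw [h, ← ih, ← ih]
      push_cast
      ring

theorem esymmOnD_euler (x ξ : ι → R) (S : Finset ι) (j : ℕ) :
    ((j : R) + 1) * esymmOnD x ξ S (j + 1)
      = ∑ i ∈ S, (ξ i * esymmOn x (S.erase i) j + x i * esymmOnD x ξ (S.erase i) j) := by
  rw [Finset.sum_add_distrib, ← esymmOnD_succ', add_mul, one_mul, add_comm]
  congr 1
  cases j with
  | zero => simp
  | succ j =>
    simp only [esymmOnD_succ', Finset.mul_sum]
    rw [Finset.sum_comm' (t' := S) (s' := fun p => S.erase p)
      (by intro a b; simp only [Finset.mem_erase, ne_eq]; tauto)]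
    refine Finset.sum_congr rfl fun p _ => ?_
    have := esymmOn_euler x (S.erase p) j
    push_cast
    rw [show ((j : R) + 1) * (ξ p * esymmOn x (S.erase p) (j + 1))
      = ξ p * (((j : R) + 1) * esymmOn x (S.erase p) (j + 1)) by ring, this, Finset.mul_sum]
    refine Finset.sum_congr rfl fun i _ => ?_
    rw [Finset.erase_right_comm]
    ring

theorem esymmOnDD_euler (x ξ : ι → R) (S : Finset ι) (j : ℕ) :
    ((j : R) + 1) * esymmOnDD x ξ S (j + 1)
      = ∑ i ∈ S, (2 * ξ i * esymmOnD x ξ (S.erase i) j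
        + x i * esymmOnDD x ξ (S.erase i) j) := by
  have h2 : ∑ i ∈ S, 2 * ξ i * esymmOnD x ξ (S.erase i) j = 2 * esymmOnDD x ξ S (j + 1) := by
    rw [esymmOnDD_succ', Finset.mul_sum]
    exact Finset.sum_congr rfl fun i _ => by ring
  rw [Finset.sum_add_distrib, h2]
  cases j with
  | zero =>
    rw [esymmOnDD_succ']
    simp
  | succ j =>
    have h3 : ∑ i ∈ S, x i * esymmOnDD x ξ (S.erase i) (j + 1)
        = ∑ p ∈ S, ξ p * ∑ i ∈ S.erase p, x i * esymmOnD x ξ ((S.erase p).erase i) j := by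
      simp only [esymmOnDD_succ', Finset.mul_sum]
      rw [Finset.sum_comm' (t' := S) (s' := fun p => S.erase p)
        (by intro a b; simp only [Finset.mem_erase, ne_eq]; tauto)]
      refine Finset.sum_congr rfl fun p _ => Finset.sum_congr rfl fun i _ => ?_
      rw [Finset.erase_right_comm]
      ring
    have h4 : ∀ p, ∑ i ∈ S.erase p, x i * esymmOnD x ξ ((S.erase p).erase i) j
        = (j : R) * esymmOnD x ξ (S.erase p) (j + 1) := fun p => by
      have := esymmOnD_euler x ξ (S.erase p) j
      rw [Finset.sum_add_distrib, ← esymmOnD_succ'] at this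
      linear_combination -this
    rw [h3]
    simp only [h4]
    have h5 : ∑ p ∈ S, ξ p * ((j : R) * esymmOnD x ξ (S.erase p) (j + 1))
        = (j : R) * esymmOnDD x ξ S (j + 1 + 1) := by
      rw [esymmOnDD_succ', Finset.mul_sum]
      exact Finset.sum_congr rfl fun i _ => by ring
    rw [h5]
    push_cast
    ring

end Recurrences

/-! ### Newton's inequality and the Gårding cone. -/

/-- Positivity of the elementary symmetric functions of degree at most `m`. -/
def InCone {ι : Type*} (x : ι → ℝ) (S : Finset ι) (m : ℕ) : Prop := ∀ j ≤ m, 0 < esymmOn x S j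

theorem InCone.mono {ι : Type*} {x : ι → ℝ} {S : Finset ι} {m m' : ℕ} (h : InCone x S m) (hm : m' ≤ m) :
    InCone x S m' := fun j hj => h j (hj.trans hm)

section Cone

variable {ι : Type*} [DecidableEq ι]

/-- Newton's inequality, in the unnormalised form. -/
theorem esymmOn_newton (x : ι → ℝ) (m : ℕ) : ∀ S : Finset ι,
    esymmOn x S m * esymmOn x S (m + 2) ≤ esymmOn x S (m + 1) ^ 2 := by
  -- Euler's identity in both factors, then expansion in each variable. The `if` encodes σ_{-1} = 0,
  -- where truncated subtraction would give σ_0 = 1.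
  have key : ∀ (S : Finset ι) (m : ℕ),
      ((m : ℝ) + 1) * esymmOn x S (m + 1) ^ 2
        - ((m : ℝ) + 2) * (esymmOn x S m * esymmOn x S (m + 2))
        = ∑ p ∈ S, x p ^ 2 * (esymmOn x (S.erase p) m ^ 2
          - (if m = 0 then 0 else esymmOn x (S.erase p) (m - 1))
            * esymmOn x (S.erase p) (m + 1)) := by
    intro S m
    have e1 := esymmOn_euler x S m
    have e2 := esymmOn_euler x S (m + 1)
    push_cast at e2
    have : ((m : ℝ) + 1) * esymmOn x S (m + 1) ^ 2
        - ((m : ℝ) + 2) * (esymmOn x S m * esymmOn x S (m + 2))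
        = esymmOn x S (m + 1) * ∑ p ∈ S, x p * esymmOn x (S.erase p) m
          - esymmOn x S m * ∑ p ∈ S, x p * esymmOn x (S.erase p) (m + 1) := by
      rw [← e1, ← e2]; ring
    rw [this, Finset.mul_sum, Finset.mul_sum, ← Finset.sum_sub_distrib]
    refine Finset.sum_congr rfl fun p hp => ?_
    rw [esymmOn_succ x hp m]
    cases m with
    | zero => simp; ring
    | succ m =>
      rw [esymmOn_succ x hp m]
      simp
      ring
  induction m with
  | zero =>
    intro S
    have h := key S 0
    have : 0 ≤ ∑ p ∈ S, x p ^ 2 * (esymmOn x (S.erase p) 0 ^ 2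
          - (if (0 : ℕ) = 0 then 0 else esymmOn x (S.erase p) (0 - 1))
            * esymmOn x (S.erase p) (0 + 1)) :=
      Finset.sum_nonneg fun p _ => by simpa using sq_nonneg (x p)
    rw [← h] at this
    norm_num at this ⊢
    nlinarith [sq_nonneg (esymmOn x S 1)]
  | succ m ih =>
    intro S
    have h := key S (m + 1)
    have : 0 ≤ ∑ p ∈ S, x p ^ 2 * (esymmOn x (S.erase p) (m + 1) ^ 2
          - (if m + 1 = 0 then 0 else esymmOn x (S.erase p) (m + 1 - 1))
            * esymmOn x (S.erase p) (m + 1 + 1)) :=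
      Finset.sum_nonneg fun p _ => by
        have := ih (S.erase p)
        simp only [Nat.succ_ne_zero, if_false, Nat.add_sub_cancel]
        exact mul_nonneg (sq_nonneg _) (by linarith)
    rw [← h] at this
    push_cast at this
    by_cases hs : esymmOn x S (m + 1) * esymmOn x S (m + 1 + 2) ≤ 0
    · exact hs.trans (sq_nonneg _)
    · push Not at hs
      have hm : (0 : ℝ) < (m : ℝ) + 1 + 1 := by positivity
      nlinarith

/-- At a first degree with σ_{j+1}(x|i) ≤ 0, positivity of σ_{j+1}(x) forces x_i > 0. Multiplying
σ_{j+2}(x) > 0 by σ_j(x|i) and using Newton then gives σ_{j+1}(x|i)·σ_{j+1}(x) > 0, a contradiction.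
-/
theorem InCone.erase {x : ι → ℝ} {S : Finset ι} {m : ℕ} (h : InCone x S (m + 1)) {i : ι}
    (hi : i ∈ S) : InCone x (S.erase i) m := by
  intro j
  induction j with
  | zero => intro _; simp
  | succ j ih =>
    intro hj
    have hpos := ih (by omega)
    by_contra! hneg
    have h1 := h (j + 1) (by omega)
    have h2 := h (j + 2) (by omega)
    rw [esymmOn_succ x hi] at h1 h2
    have hN := esymmOn_newton x j (S.erase i)
    have hx : 0 < x i := by
      by_contra! hx
      nlinarith
    have h3 : 0 < esymmOn x (S.erase i) j * esymmOn x (S.erase i) (j + 2)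
        + esymmOn x (S.erase i) (j + 1) * (x i * esymmOn x (S.erase i) j) := by
      have := mul_pos hpos h2
      nlinarith
    nlinarith [mul_nonneg (neg_nonneg.2 hneg) h1.le]

end Cone

/-! ### Quotients of consecutive σ's as sums of harmonic combinations. -/

section Quotients

variable {ι : Type*}

/-- The quotient `σ_{m+1} / σ_m` in the variables `x i`, `i ∈ S`. -/
noncomputable def esymmQuot (x : ι → ℝ) (S : Finset ι) (m : ℕ) : ℝ :=
  esymmOn x S (m + 1) / esymmOn x S m

variable [DecidableEq ι]

/-- The derivative of `esymmQuot x S m` in the direction `ξ`. -/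
noncomputable def esymmQuotD (x ξ : ι → ℝ) (S : Finset ι) (m : ℕ) : ℝ :=
  (esymmOnD x ξ S (m + 1) - esymmQuot x S m * esymmOnD x ξ S m) / esymmOn x S m

/-- The second derivative of `esymmQuot x S m` in the direction `ξ`. -/
noncomputable def esymmQuotDD (x ξ : ι → ℝ) (S : Finset ι) (m : ℕ) : ℝ :=
  (esymmOnDD x ξ S (m + 1) - 2 * esymmQuotD x ξ S m * esymmOnD x ξ S m
    - esymmQuot x S m * esymmOnDD x ξ S m) / esymmOn x S m

/-- The quotient `σ_{m+1}(x) / σ_m(x|i) = x i + σ_{m+1}(x|i) / σ_m(x|i)`. -/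
noncomputable def esymmPivot (x : ι → ℝ) (S : Finset ι) (m : ℕ) (i : ι) : ℝ :=
  x i + esymmQuot x (S.erase i) m

/-- The harmonic combination of `x i` and `σ_{m+1}(x|i) / σ_m(x|i)`. -/
noncomputable def esymmHarm (x : ι → ℝ) (S : Finset ι) (m : ℕ) (i : ι) : ℝ :=
  x i * esymmQuot x (S.erase i) m / esymmPivot x S m i

/-- The cross term in the derivatives of `esymmHarm x S m i` in the direction `ξ`. -/
noncomputable def esymmCross (x ξ : ι → ℝ) (S : Finset ι) (m : ℕ) (i : ι) : ℝ :=
  (esymmQuot x (S.erase i) m * ξ i - x i * esymmQuotD x ξ (S.erase i) m) / esymmPivot x S m i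

variable {x ξ : ι → ℝ} {S : Finset ι} {m : ℕ} {i : ι}

omit [DecidableEq ι] in
theorem esymmOn_eq_quot_mul (h : esymmOn x S m ≠ 0) :
    esymmOn x S (m + 1) = esymmQuot x S m * esymmOn x S m := by
  rw [esymmQuot, div_mul_cancel₀ _ h]

theorem esymmOnD_eq_quot (h : esymmOn x S m ≠ 0) :
    esymmOnD x ξ S (m + 1)
      = esymmQuotD x ξ S m * esymmOn x S m + esymmQuot x S m * esymmOnD x ξ S m := by
  rw [esymmQuotD, div_mul_cancel₀ _ h]
  ring

theorem esymmOnDD_eq_quot (h : esymmOn x S m ≠ 0) :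
    esymmOnDD x ξ S (m + 1)
      = esymmQuotDD x ξ S m * esymmOn x S m + 2 * esymmQuotD x ξ S m * esymmOnD x ξ S m
        + esymmQuot x S m * esymmOnDD x ξ S m := by
  rw [esymmQuotDD, div_mul_cancel₀ _ h]
  ring

theorem esymmOn_eq_pivot_mul (hi : i ∈ S) (h : esymmOn x (S.erase i) m ≠ 0) :
    esymmOn x S (m + 1) = esymmPivot x S m i * esymmOn x (S.erase i) m := by
  rw [esymmOn_succ x hi, esymmOn_eq_quot_mul h, esymmPivot]
  ring

theorem InCone.pivot_pos (h : InCone x S (m + 1)) (hi : i ∈ S) : 0 < esymmPivot x S m i := by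
  have h1 := (h.erase hi) m le_rfl
  have h2 := h (m + 1) le_rfl
  rw [esymmOn_eq_pivot_mul hi h1.ne'] at h2
  exact pos_of_mul_pos_left h2 h1.le

theorem InCone.harm_eq (h : InCone x S (m + 1)) (hi : i ∈ S) :
    esymmHarm x S m i = x i - x i ^ 2 / esymmPivot x S m i := by
  have hy := h.pivot_pos hi
  rw [esymmHarm]
  field_simp
  rw [esymmPivot]
  ring

/-- Euler's identity divided by σ_{m+1}. With p = σ_{m+1}(x|i)/σ_m(x|i), each summand is xp/(x+p),
concave and increasing in p; the next two lemmas differentiate it once and twice. -/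
theorem InCone.quot_eq_sum (h : InCone x S (m + 1)) :
    ((m : ℝ) + 2) * esymmQuot x S (m + 1) = ∑ i ∈ S, esymmHarm x S m i := by
  have ha := h (m + 1) le_rfl
  have e := esymmOn_euler x S (m + 1)
  push_cast at e
  rw [esymmQuot, ← mul_div_assoc, div_eq_iff ha.ne',
    show ((m : ℝ) + 2) = (m : ℝ) + 1 + 1 by ring, e, Finset.sum_mul]
  refine Finset.sum_congr rfl fun i hi => ?_
  have h1 := (h.erase hi) m le_rfl
  have hy := h.pivot_pos hi
  rw [esymmOn_eq_pivot_mul hi h1.ne', esymmOn_eq_quot_mul h1.ne', esymmHarm]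
  field_simp

theorem InCone.quotD_eq_sum (h : InCone x S (m + 1)) :
    ((m : ℝ) + 2) * esymmQuotD x ξ S (m + 1)
      = ∑ i ∈ S, (esymmQuot x (S.erase i) m * esymmCross x ξ S m i
          + x i * esymmQuotD x ξ (S.erase i) m) / esymmPivot x S m i := by
  have ha := h (m + 1) le_rfl
  have e := esymmOnD_euler x ξ S (m + 1)
  push_cast at e
  have e0 := h.quot_eq_sum
  rw [esymmQuotD, ← mul_div_assoc, div_eq_iff ha.ne', mul_sub, ← mul_assoc, e0,
    show ((m : ℝ) + 2) = (m : ℝ) + 1 + 1 by ring, e, Finset.sum_mul, Finset.sum_mul,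
    ← Finset.sum_sub_distrib]
  refine Finset.sum_congr rfl fun i hi => ?_
  have h1 := (h.erase hi) m le_rfl
  have hy := h.pivot_pos hi
  rw [esymmOn_eq_pivot_mul hi h1.ne', esymmOnD_succ x ξ hi, esymmOn_eq_quot_mul h1.ne',
    esymmOnD_eq_quot h1.ne', esymmHarm, esymmCross]
  unfold esymmPivot at hy ⊢
  field_simp
  ring

theorem InCone.quotDD_eq_sum (h : InCone x S (m + 1)) :
    ((m : ℝ) + 2) * esymmQuotDD x ξ S (m + 1)
      = ∑ i ∈ S, (-(2 * esymmCross x ξ S m i ^ 2 / esymmPivot x S m i)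
          + (x i / esymmPivot x S m i) ^ 2 * esymmQuotDD x ξ (S.erase i) m) := by
  have ha := h (m + 1) le_rfl
  have e := esymmOnDD_euler x ξ S (m + 1)
  push_cast at e
  have e0 := h.quot_eq_sum
  have e1 := h.quotD_eq_sum (ξ := ξ)
  rw [esymmQuotDD, ← mul_div_assoc, div_eq_iff ha.ne', mul_sub, mul_sub,
    show ∀ a b c : ℝ, a * (2 * b * c) = 2 * ((a * b) * c) by intros; ring, e1,
    ← mul_assoc ((m : ℝ) + 2) (esymmQuot x S (m + 1)), e0, show ((m : ℝ) + 2) = (m : ℝ) + 1 + 1 by ring, e, Finset.sum_mul,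
    Finset.sum_mul, Finset.mul_sum, Finset.sum_mul, ← Finset.sum_sub_distrib,
    ← Finset.sum_sub_distrib]
  refine Finset.sum_congr rfl fun i hi => ?_
  have h1 := (h.erase hi) m le_rfl
  have hy := h.pivot_pos hi
  rw [esymmOn_eq_pivot_mul hi h1.ne', esymmOnD_succ x ξ hi, esymmOnDD_succ x ξ hi,
    esymmOnD_eq_quot h1.ne', esymmOnDD_eq_quot h1.ne', esymmHarm, esymmCross]
  unfold esymmPivot at hy ⊢
  field_simp
  ring

/-- Each summand of the second derivative is minus a square plus a nonnegative multiple of the same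
quantity one degree lower. -/
theorem InCone.quotDD_nonpos (h : InCone x S m) : esymmQuotDD x ξ S m ≤ 0 := by
  induction m generalizing S with
  | zero =>
    have h1 : esymmOnDD x ξ S 1 = 0 := by simp [esymmOnDD_succ']
    simp [esymmQuotDD, h1]
  | succ m ih =>
    have e := h.quotDD_eq_sum (ξ := ξ)
    have : ((m : ℝ) + 2) * esymmQuotDD x ξ S (m + 1) ≤ 0 := by
      rw [e]
      refine Finset.sum_nonpos fun i hi => ?_
      have hy := h.pivot_pos hi
      have h1 : 0 ≤ 2 * esymmCross x ξ S m i ^ 2 / esymmPivot x S m i := by positivity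
      have h2 := mul_nonpos_of_nonneg_of_nonpos (sq_nonneg (x i / esymmPivot x S m i))
        (ih (h.erase hi))
      linarith
    by_contra! hc
    have : 0 < ((m : ℝ) + 2) * esymmQuotDD x ξ S (m + 1) := by positivity
    linarith

/-- Concavity of `σ_{m+1}^{1/(m+1)}`, in infinitesimal form. -/
theorem InCone.esymmOnDD_mul_le (h : InCone x S (m + 1)) :
    ((m : ℝ) + 1) * (esymmOnDD x ξ S (m + 1) * esymmOn x S (m + 1))
      ≤ m * esymmOnD x ξ S (m + 1) ^ 2 := by
  induction m with
  | zero =>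
    have h1 : esymmOnDD x ξ S 1 = 0 := by simp [esymmOnDD_succ']
    simp [h1]
  | succ m ih =>
    have h0 := h (m + 1) (by omega)
    have h1 := h (m + 2) le_rfl
    have hq := (h.mono (Nat.le_succ _)).quotDD_nonpos (ξ := ξ)
    have ih := ih (h.mono (Nat.le_succ _))
    rw [esymmOnDD_eq_quot h0.ne', esymmOnD_eq_quot h0.ne', esymmOn_eq_quot_mul h0.ne']
    rw [esymmOn_eq_quot_mul h0.ne'] at h1
    have hq0 := pos_of_mul_pos_left h1 h0.le
    set q := esymmQuot x S (m + 1)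
    set q1 := esymmQuotD x ξ S (m + 1)
    set q2 := esymmQuotDD x ξ S (m + 1)
    set a := esymmOn x S (m + 1)
    set b := esymmOnD x ξ S (m + 1)
    set c := esymmOnDD x ξ S (m + 1)
    have hm : (0 : ℝ) < (m : ℝ) + 1 := by positivity
    have h2 : ((m : ℝ) + 2) * (q2 * a ^ 2 * q) ≤ 0 :=
      mul_nonpos_of_nonneg_of_nonpos (by positivity)
        (by nlinarith [mul_pos (pow_pos h0 2) hq0])
    -- With σ_{m+2} = q·a, dropping q'' ≤ 0 and inserting the induction bound for a leaves exactly
    -- this square.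
    have h3 : 0 ≤ ((m : ℝ) + 1) * (q1 * a - q * b / ((m : ℝ) + 1)) ^ 2 := by positivity
    have h4 : ((m : ℝ) + 1) * (q1 * a - q * b / ((m : ℝ) + 1)) ^ 2
        = ((m : ℝ) + 1) * (q1 * a) ^ 2 - 2 * (q1 * a) * (q * b) + (q * b) ^ 2 / ((m : ℝ) + 1) := by
      field_simp
      ring
    have h5 : ((m : ℝ) + 2) * q ^ 2 * (c * a)
        ≤ ((m : ℝ) + 1) * (q * b) ^ 2 - (q * b) ^ 2 / ((m : ℝ) + 1) := by
      have : c * a ≤ m * b ^ 2 / ((m : ℝ) + 1) := by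
        rw [le_div_iff₀ hm]; linarith
      calc ((m : ℝ) + 2) * q ^ 2 * (c * a)
          ≤ ((m : ℝ) + 2) * q ^ 2 * (m * b ^ 2 / ((m : ℝ) + 1)) :=
            mul_le_mul_of_nonneg_left this (by positivity)
        _ = _ := by field_simp; ring
    push_cast
    nlinarith

theorem InCone.harm_le_self (h : InCone x S (m + 1)) (hi : i ∈ S) : esymmHarm x S m i ≤ x i := by
  have hy := h.pivot_pos hi
  have h2 : 0 ≤ x i ^ 2 / esymmPivot x S m i := by positivity
  linarith [h.harm_eq hi]

theorem InCone.harm_le {C : ℝ} (h : InCone x S (m + 1)) (hi : i ∈ S) (hx : 0 < x i)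
    (hC : 0 ≤ C) (hp : esymmQuot x (S.erase i) m ≤ C) : esymmHarm x S m i ≤ C := by
  have hy := h.pivot_pos hi
  rw [esymmHarm, div_le_iff₀ hy, esymmPivot]
  rw [esymmPivot] at hy
  by_cases hp0 : esymmQuot x (S.erase i) m ≤ 0
  · exact (mul_nonpos_of_nonneg_of_nonpos hx.le hp0).trans (mul_nonneg hC hy.le)
  · push Not at hp0
    nlinarith [mul_nonneg hC hp0.le, mul_le_mul_of_nonneg_left hp hx.le]

theorem InCone.one_div_pivot (h : InCone x S (m + 1)) (hi : i ∈ S) :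
    esymmOn x (S.erase i) m / esymmOn x S (m + 1) = 1 / esymmPivot x S m i := by
  have h1 := (h.erase hi) m le_rfl
  have hy := h.pivot_pos hi
  rw [esymmOn_eq_pivot_mul hi h1.ne']
  field_simp

/-- If at most `m` of the variables exceed `c`, then `σ_{m+1} / σ_m` is at most a multiple
of `c`. -/
theorem InCone.quot_le {c N : ℝ} (hc : 0 ≤ c) {L : Finset ι} (h : InCone x S m) (hLS : L ⊆ S)
    (hL : L.card ≤ m) (hpos : ∀ i ∈ L, 0 < x i) (hsm : ∀ j ∈ S, j ∉ L → x j ≤ c)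
    (hN : (S.card : ℝ) ≤ N) : esymmQuot x S m ≤ N * c := by
  induction m generalizing S L with
  | zero =>
    have hL0 : L = ∅ := Finset.card_eq_zero.1 (by omega)
    have e := esymmOn_euler x S 0
    have : esymmQuot x S 0 = ∑ i ∈ S, x i := by
      simpa [esymmQuot] using e
    rw [this]
    calc ∑ i ∈ S, x i ≤ ∑ _i ∈ S, c :=
          Finset.sum_le_sum fun i hi => hsm i hi (by simp [hL0])
      _ = S.card * c := by simp
      _ ≤ N * c := by gcongr
  | succ m ih =>
    have e := h.quot_eq_sum
    have hN0 : 0 ≤ N * c := mul_nonneg ((Nat.cast_nonneg _).trans hN) hc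
    have hsmall : ∀ i ∈ S \ L, esymmHarm x S m i ≤ c := by
      intro i hi
      rw [Finset.mem_sdiff] at hi
      exact (h.harm_le_self hi.1).trans (hsm i hi.1 hi.2)
    have hlarge : ∀ i ∈ L, esymmHarm x S m i ≤ N * c := by
      intro i hi
      have hiS := hLS hi
      refine h.harm_le hiS (hpos i hi) hN0 ?_
      refine ih (h.erase hiS) (Finset.erase_subset_erase i hLS)
        (by rw [Finset.card_erase_of_mem hi]; omega)
        (fun j hj => hpos j (Finset.mem_of_mem_erase hj)) (fun j hj hjL => ?_)
        ((Nat.cast_le.2 (Finset.card_le_card (Finset.erase_subset i S))).trans hN)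
      exact hsm j (Finset.mem_of_mem_erase hj)
        fun hj' => hjL (Finset.mem_erase.2 ⟨Finset.ne_of_mem_erase hj, hj'⟩)
    -- The small indices contribute Nc in total, and each of the at most m + 1 large ones another
    -- Nc; the factor m + 2 cancels, so the constant does not grow with m.
    have hsum : ((m : ℝ) + 2) * esymmQuot x S (m + 1) ≤ ((m : ℝ) + 2) * (N * c) := by
      rw [e, ← Finset.sum_sdiff hLS]
      have h1 : ∑ i ∈ S \ L, esymmHarm x S m i ≤ N * c := by
        refine (Finset.sum_le_sum hsmall).trans ?_
        rw [Finset.sum_const, nsmul_eq_mul]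
        exact mul_le_mul_of_nonneg_right
          ((Nat.cast_le.2 (Finset.card_le_card Finset.sdiff_subset)).trans hN) hc
      have h2 : ∑ i ∈ L, esymmHarm x S m i ≤ ((m : ℝ) + 1) * (N * c) := by
        refine (Finset.sum_le_sum hlarge).trans ?_
        rw [Finset.sum_const, nsmul_eq_mul]
        exact mul_le_mul_of_nonneg_right (by exact_mod_cast hL) hN0
      linarith
    exact le_of_mul_le_mul_left hsum (by positivity)

end Quotients

/-! ### The inductive step for the derivative of a quotient. -/

section Core

theorem cauchy_two {a b A B X C : ℝ} (hA : 0 ≤ A) (hB : 0 ≤ B) (hX : 0 ≤ X) (hC : 0 ≤ C)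
    (ha : a ^ 2 ≤ A * B) (hb : b ^ 2 ≤ X * C) : (a + b) ^ 2 ≤ (A + X) * (B + C) := by
  have h1 : (2 * (a * b)) ^ 2 ≤ (A * C + X * B) ^ 2 := by
    have : a ^ 2 * b ^ 2 ≤ (A * B) * (X * C) :=
      mul_le_mul ha hb (sq_nonneg b) (mul_nonneg hA hB)
    nlinarith [sq_nonneg (A * C - X * B)]
  have h2 := abs_le_of_sq_le_sq h1 (by positivity)
  have h3 := (abs_le.1 h2).2
  nlinarith

/-- Used for a small index: the derivative of xp/(x+p) is written through ξ_i and the cross term e,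
eliminating p'. The defect is a perfect square. -/
theorem cauchy_cross {p ζ v e y τ : ℝ} (hy : 0 < y) (hτ : 0 < τ) :
    ((p * ζ - v * e) / y) ^ 2
      ≤ (v ^ 2 / (2 * y) + p ^ 2 / (2 * τ * y)) * (2 * e ^ 2 / y + 2 * τ * ζ ^ 2 / y) := by
  have : (v ^ 2 / (2 * y) + p ^ 2 / (2 * τ * y)) * (2 * e ^ 2 / y + 2 * τ * ζ ^ 2 / y)
      - ((p * ζ - v * e) / y) ^ 2 = (τ * v * ζ + p * e) ^ 2 / (τ * y ^ 2) := by
    field_simp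
    ring
  have h2 : 0 ≤ (τ * v * ζ + p * e) ^ 2 / (τ * y ^ 2) := by positivity
  linarith

/-- Used for a large index: the same derivative, now written through e and p', with p' controlled by
the induction hypothesis. -/
theorem cauchy_large {p e v p₁ y X W : ℝ} (hy : 0 < y) (hX : 0 ≤ X) (hW : 0 ≤ W)
    (h : p₁ ^ 2 ≤ X * W) :
    ((p * e + v * p₁) / y) ^ 2 ≤ (p ^ 2 / (2 * y) + X) * (2 * e ^ 2 / y + (v / y) ^ 2 * W) := by
  rw [add_div]
  refine cauchy_two (by positivity) (by positivity) hX (by positivity) ?_ ?_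
  · refine le_of_eq ?_
    field_simp
  · calc (v * p₁ / y) ^ 2 = (v / y) ^ 2 * p₁ ^ 2 := by ring
      _ ≤ (v / y) ^ 2 * (X * W) := mul_le_mul_of_nonneg_left h (sq_nonneg _)
      _ = _ := by ring

/-- The parameter tρ(v+p)/v is the one for which the cost of a large index is again a multiple of
−vp/(v+p), with κ' replaced by ρκ'. Summing over i then reproduces −q. -/
theorem cost_large {p v t κ' ρ : ℝ} (hy : 0 < v + p) (ht : 0 < t) (hκ : 0 < κ')
    (hρ : 0 < ρ) :
    p ^ 2 / (2 * (v + p)) + 1 / 2 * (1 + 1 / (t * ρ * ((v + p) / v) * κ')) * (-p)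
      = 1 / 2 * (1 + 1 / (t * (ρ * κ'))) * (-(v * p / (v + p))) := by
  field_simp
  ring

/-- Same multiple of −vp/(v+p) as for a large index; the rest is linear in v and p, both at most of
order θu for a small index. -/
theorem cost_small {p v τ : ℝ} (hy : 0 < v + p) (hτ : 0 < τ) :
    v ^ 2 / (2 * (v + p)) + p ^ 2 / (2 * τ * (v + p))
      = 1 / 2 * (1 + 1 / τ) * (-(v * p / (v + p))) + (1 / 2 * v + 1 / 2 * (1 / τ) * p) := by
  field_simp
  ring

theorem div_pivot_eq {p v : ℝ} (hy : 0 < v + p) (hv : 0 < v) :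
    v / (v + p) = 1 + -(v * p / (v + p)) / v := by
  field_simp
  ring

variable {ι : Type*} [DecidableEq ι] {x ξ : ι → ℝ} {S L : Finset ι} {m : ℕ}

set_option maxHeartbeats 1000000 in
/-- One step of the induction on the number of large variables: a bound for the derivative of
`σ_{m+2} / σ_{m+1}` follows from bounds for `σ_{m+1} / σ_m` with one large variable removed. -/
theorem InCone.quotD_sq_le_step {K : ℕ} (hK : 2 ≤ K) {N Θ ρ θ u κ κ' M t : ℝ}
    (hΘ : 0 < Θ) (hρ : 1 / 2 ≤ ρ) (hρ1 : ρ ≤ 1) (hu : 0 < u) (hθ : 0 ≤ θ) (hθ1 : θ ≤ 1)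
    (hθΘ : θ ≤ (1 - ρ) * Θ) (hκ : 1 ≤ κ) (hκK : κ ≤ K) (hκ' : κ = ρ * κ') (hM : 0 ≤ M)
    (ht : 0 < t) (hm : m + 2 = K + L.card) (hLS : L ⊆ S) (hN1 : 1 ≤ N) (hN : (S.card : ℝ) ≤ N)
    (h : InCone x S (m + 1)) (hlarge : ∀ i ∈ L, Θ * u ≤ x i)
    (hsmall : ∀ j ∈ S, j ∉ L → x j ≤ θ * u) (hq : -u ≤ esymmQuot x S (m + 1))
    (hsub : ∀ i ∈ L, ∀ t : ℝ, 0 < t →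
      0 ≤ 1 / 2 * (1 + 1 / (t * κ')) * (-esymmQuot x (S.erase i) m)
        + M * θ * u * (1 + 1 / t) ∧
      esymmQuotD x ξ (S.erase i) m ^ 2
        ≤ (1 / 2 * (1 + 1 / (t * κ')) * (-esymmQuot x (S.erase i) m) + M * θ * u * (1 + 1 / t))
          * (-esymmQuotDD x ξ (S.erase i) m + t * (2 * ∑ j ∈ S \ L, ξ j ^ 2 *
            (esymmOn x ((S.erase i).erase j) (m - 1) / esymmOn x (S.erase i) m)))) :
    0 ≤ 1 / 2 * (1 + 1 / (t * κ)) * (-esymmQuot x S (m + 1))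
        + (N ^ 2 + 2 * (1 + ((m : ℝ) + 2 + N ^ 2) / Θ) * M) * θ * u * (1 + 1 / t) ∧
      esymmQuotD x ξ S (m + 1) ^ 2
        ≤ (1 / 2 * (1 + 1 / (t * κ)) * (-esymmQuot x S (m + 1))
          + (N ^ 2 + 2 * (1 + ((m : ℝ) + 2 + N ^ 2) / Θ) * M) * θ * u * (1 + 1 / t))
          * (-esymmQuotDD x ξ S (m + 1) + t * (2 * ∑ j ∈ S \ L, ξ j ^ 2 *
            (esymmOn x (S.erase j) m / esymmOn x S (m + 1)))) := by
  set D : ℝ := 1 + ((m : ℝ) + 2 + N ^ 2) / Θ with hD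
  have hD1 : 1 ≤ D := by
    have : 0 ≤ ((m : ℝ) + 2 + N ^ 2) / Θ := by positivity
    linarith
  have hκ0 : 0 < κ := by linarith
  have hκ'0 : 0 < κ' := by
    by_contra! hc
    nlinarith
  have hθu : 0 ≤ θ * u := mul_nonneg hθ hu.le
  have hNθ : 0 ≤ N * (θ * u) := by positivity
  have ht' : 0 < 1 / t := by positivity
  have hpx : ∀ i ∈ L, 0 < x i := fun i hi => (by positivity : 0 < Θ * u).trans_le (hlarge i hi)
  have hLm : L.card ≤ m := by omega
  have hp : ∀ i ∈ S, esymmQuot x (S.erase i) m ≤ N * (θ * u) := by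
    intro i hi
    have hcard : ((S.erase i).card : ℝ) ≤ N :=
      (Nat.cast_le.2 (Finset.card_le_card (Finset.erase_subset i S))).trans hN
    refine (h.erase hi).quot_le hθu (Finset.erase_subset_erase i hLS)
      ((Finset.card_le_card (Finset.erase_subset i L)).trans hLm)
      (fun j hj => hpx j (Finset.mem_of_mem_erase hj)) (fun j hj hjL => ?_) hcard
    exact hsmall j (Finset.mem_of_mem_erase hj)
      fun hj' => hjL (Finset.mem_erase.2 ⟨Finset.ne_of_mem_erase hj, hj'⟩)
  have hharm : ∀ i ∈ S, esymmHarm x S m i ≤ N * (θ * u) := by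
    intro i hi
    by_cases hiL : i ∈ L
    · exact h.harm_le hi (hpx i hiL) hNθ (hp i hi)
    · refine (h.harm_le_self hi).trans ((hsmall i hi hiL).trans ?_)
      nlinarith
  have hsumh := h.quot_eq_sum
  -- The harmonic terms sum to (m+2)q ≥ −(m+2)u and each is at most Nθu, so none can be very
  -- negative.
  have hharm' : ∀ i ∈ S, -esymmHarm x S m i ≤ ((m : ℝ) + 2 + N ^ 2) * u := by
    intro i hi
    rw [← Finset.add_sum_erase S _ hi] at hsumh
    have h1 : ∑ j ∈ S.erase i, esymmHarm x S m j ≤ N * (N * (θ * u)) := by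
      refine (Finset.sum_le_sum fun j hj => hharm j (Finset.mem_of_mem_erase hj)).trans ?_
      rw [Finset.sum_const, nsmul_eq_mul]
      exact mul_le_mul_of_nonneg_right
        ((Nat.cast_le.2 (Finset.card_le_card (Finset.erase_subset i S))).trans hN) hNθ
    have h2 : ((m : ℝ) + 2) * (-u) ≤ ((m : ℝ) + 2) * esymmQuot x S (m + 1) :=
      mul_le_mul_of_nonneg_left hq (by positivity)
    have h3 : N * (N * (θ * u)) ≤ N ^ 2 * u := by
      have : θ * u ≤ u := by nlinarith
      nlinarith [mul_le_mul_of_nonneg_left this (sq_nonneg N)]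
    linarith
  set T : ℝ := 2 * ∑ j ∈ S \ L, ξ j ^ 2 * (esymmOn x (S.erase j) m / esymmOn x S (m + 1)) with hT
  set c : ℝ := 1 / 2 * (1 + 1 / (t * κ)) with hc
  set EL : ℝ := 2 * D * M * (θ * u) * (1 + 1 / t) with hEL
  set ES : ℝ := N * (θ * u) * (1 + 1 / t) with hES
  have hT' : T = ∑ j ∈ S \ L, 2 * ξ j ^ 2 / esymmPivot x S m j := by
    rw [hT, Finset.mul_sum]
    refine Finset.sum_congr rfl fun j hj => ?_
    rw [h.one_div_pivot (Finset.mem_sdiff.1 hj).1]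
    ring
  have hT0 : 0 ≤ T := by
    rw [hT']
    refine Finset.sum_nonneg fun j hj => ?_
    have := h.pivot_pos (Finset.mem_sdiff.1 hj).1
    positivity
  have key : ∀ i ∈ S, ∃ X Y : ℝ, 0 ≤ X ∧ 0 ≤ Y ∧
      ((esymmQuot x (S.erase i) m * esymmCross x ξ S m i
          + x i * esymmQuotD x ξ (S.erase i) m) / esymmPivot x S m i) ^ 2 ≤ X * Y ∧
      X ≤ c * (-esymmHarm x S m i) + (if i ∈ L then EL else ES) ∧
      Y ≤ (2 * esymmCross x ξ S m i ^ 2 / esymmPivot x S m i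
          + (x i / esymmPivot x S m i) ^ 2 * (-esymmQuotDD x ξ (S.erase i) m))
        + (if i ∈ L then t * T else t * κ * (2 * ξ i ^ 2 / esymmPivot x S m i)) := by
    intro i hi
    have hy := h.pivot_pos hi
    have hyp : esymmPivot x S m i = x i + esymmQuot x (S.erase i) m := rfl
    have hcr : esymmCross x ξ S m i * esymmPivot x S m i
        = esymmQuot x (S.erase i) m * ξ i - x i * esymmQuotD x ξ (S.erase i) m :=
      div_mul_cancel₀ _ hy.ne'
    have hh : esymmHarm x S m i = x i * esymmQuot x (S.erase i) m / esymmPivot x S m i := rfl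
    have hdd := (h.erase hi).quotDD_nonpos (ξ := ξ)
    have hpi := hp i hi
    have hhi := hharm' i hi
    set y := esymmPivot x S m i
    set p := esymmQuot x (S.erase i) m
    set e := esymmCross x ξ S m i
    set p1 := esymmQuotD x ξ (S.erase i) m
    set p2 := esymmQuotDD x ξ (S.erase i) m
    by_cases hiL : i ∈ L
    · simp only [hiL, if_true]
      have hx := hpx i hiL
      -- This parameter makes the cost exact in `cost_large`, and turns (x_i/y)²·t'T' into
      -- tρ(x_i/y)T', which is at most tT.
      obtain ⟨hX, hp1⟩ := hsub i hiL (t * ρ * (y / x i)) (by positivity)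
      set t' := t * ρ * (y / x i) with ht'd
      set X' := 1 / 2 * (1 + 1 / (t' * κ')) * (-p) + M * θ * u * (1 + 1 / t') with hX'
      set T' := 2 * ∑ j ∈ S \ L, ξ j ^ 2 *
            (esymmOn x ((S.erase i).erase j) (m - 1) / esymmOn x (S.erase i) m) with hT'd
      have hm1 : m - 1 + 1 = m := by
        have := Finset.card_pos.2 ⟨i, hiL⟩
        omega
      have hcm := (h.erase hi) m le_rfl
      -- Expanding σ_m(x|i) > 0 in x_j gives σ_m(x|ij) ≥ −x_j σ_{m-1}(x|ij), and x_j ≤ (1−ρ)x_i by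
      -- the gap.
      have hterm : ∀ j ∈ S \ L, 0 < esymmOn x ((S.erase i).erase j) (m - 1) ∧
          ρ * x i * esymmOn x ((S.erase i).erase j) (m - 1) ≤ esymmOn x (S.erase j) m := by
        intro j hj
        rw [Finset.mem_sdiff] at hj
        have hji : j ≠ i := fun hji => hj.2 (hji ▸ hiL)
        have hjS : j ∈ S.erase i := Finset.mem_erase.2 ⟨hji, hj.1⟩
        have hiS : i ∈ S.erase j := Finset.mem_erase.2 ⟨hji.symm, hi⟩
        have hc1 : InCone x (S.erase i) (m - 1 + 1) := by rw [hm1]; exact h.erase hi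
        have hpos := (hc1.erase hjS) (m - 1) le_rfl
        refine ⟨hpos, ?_⟩
        have e1 := esymmOn_succ x hjS (m - 1)
        have e2 := esymmOn_succ x hiS (m - 1)
        rw [hm1] at e1 e2
        rw [Finset.erase_right_comm] at e2
        have hxj : x j ≤ (1 - ρ) * x i := by
          have h1 := hsmall j hj.1 hj.2
          have h2 := hlarge i hiL
          have h3 : θ * u ≤ (1 - ρ) * Θ * u := mul_le_mul_of_nonneg_right hθΘ hu.le
          have h4 : (1 - ρ) * (Θ * u) ≤ (1 - ρ) * x i :=
            mul_le_mul_of_nonneg_left h2 (by linarith)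
          linarith
        have := mul_le_mul_of_nonneg_right hxj hpos.le
        linarith
      have hT'0 : 0 ≤ T' :=
        mul_nonneg zero_le_two (Finset.sum_nonneg fun j hj =>
          mul_nonneg (sq_nonneg _) (div_nonneg (hterm j hj).1.le hcm.le))
      have hTT : (x i / y) ^ 2 * (t' * T') ≤ t * T := by
        have h1 : (x i / y) ^ 2 * (t' * T') = t * ((x i / y * ρ) * T') := by
          rw [ht'd]; field_simp
        rw [h1]
        refine mul_le_mul_of_nonneg_left ?_ ht.le
        rw [hT'd, hT, mul_left_comm, Finset.mul_sum]
        refine mul_le_mul_of_nonneg_left (Finset.sum_le_sum fun j hj => ?_) zero_le_two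
        rw [mul_left_comm]
        refine mul_le_mul_of_nonneg_left ?_ (sq_nonneg _)
        rw [esymmOn_eq_pivot_mul hi hcm.ne']
        have h2 := (hterm j hj).2
        change _ ≤ esymmOn x (S.erase j) m / (y * esymmOn x (S.erase i) m)
        rw [show x i / y * ρ * (esymmOn x ((S.erase i).erase j) (m - 1)
            / esymmOn x (S.erase i) m)
            = ρ * x i * esymmOn x ((S.erase i).erase j) (m - 1)
              / (y * esymmOn x (S.erase i) m) by field_simp]
        exact div_le_div_of_nonneg_right h2 (by positivity)
      have hW : 0 ≤ -p2 + t' * T' := by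
        have : 0 ≤ t' * T' := mul_nonneg (by positivity) hT'0
        linarith
      refine ⟨p ^ 2 / (2 * y) + X', 2 * e ^ 2 / y + (x i / y) ^ 2 * (-p2 + t' * T'),
        by positivity, by positivity, ?_, ?_, ?_⟩
      · exact cauchy_large hy hX hW hp1
      · have h1 : p ^ 2 / (2 * y) + 1 / 2 * (1 + 1 / (t' * κ')) * (-p)
            = c * (-esymmHarm x S m i) := by
          rw [hc, hh, ht'd, hκ', hyp]
          exact cost_large (hyp ▸ hy) ht hκ'0 (by linarith)
        have h2 : x i / y ≤ D := by
          have h3 : x i / y = 1 + (-esymmHarm x S m i) / x i := by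
            rw [hh, hyp]
            exact div_pivot_eq (hyp ▸ hy) hx
          rw [h3, hD]
          have h4 : (-esymmHarm x S m i) / x i ≤ ((m : ℝ) + 2 + N ^ 2) / Θ := by
            rw [div_le_div_iff₀ hx hΘ]
            have h5 := mul_le_mul_of_nonneg_right hhi hΘ.le
            have h6 : ((m : ℝ) + 2 + N ^ 2) * (Θ * u) ≤ ((m : ℝ) + 2 + N ^ 2) * x i :=
              mul_le_mul_of_nonneg_left (hlarge i hiL) (by positivity)
            linarith
          linarith
        have h3 : 1 + 1 / t' ≤ 2 * D * (1 + 1 / t) := by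
          have : 1 / t' = x i / y * (1 / ρ) * (1 / t) := by rw [ht'd]; field_simp
          have h4 : 1 / ρ ≤ 2 := by
            rw [div_le_iff₀ (by linarith)]; linarith
          have h5 : x i / y * (1 / ρ) ≤ D * 2 :=
            mul_le_mul h2 h4 (by positivity) (by linarith)
          have h6 := mul_le_mul_of_nonneg_right h5 ht'.le
          rw [this]
          linarith
        have h4 : M * θ * u * (1 + 1 / t') ≤ EL := by
          have : 0 ≤ M * θ * u := by positivity
          calc M * θ * u * (1 + 1 / t') ≤ M * θ * u * (2 * D * (1 + 1 / t)) :=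
                mul_le_mul_of_nonneg_left h3 this
            _ = EL := by rw [hEL]; ring
        rw [hX']
        linarith
      · rw [mul_add]
        linarith
    · simp only [hiL, if_false]
      refine ⟨x i ^ 2 / (2 * y) + p ^ 2 / (2 * (t * κ) * y),
        2 * e ^ 2 / y + 2 * (t * κ) * ξ i ^ 2 / y, by positivity, by positivity, ?_, ?_, ?_⟩
      · have h1 : p * e + x i * p1 = p * ξ i - x i * e := by
          rw [hyp] at hcr
          linarith
        rw [h1]
        exact cauchy_cross hy (by positivity)
      · have h1 : x i ^ 2 / (2 * y) + p ^ 2 / (2 * (t * κ) * y)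
            = c * (-esymmHarm x S m i) + (1 / 2 * x i + 1 / 2 * (1 / (t * κ)) * p) := by
          rw [hc, hh, hyp]
          exact cost_small (hyp ▸ hy) (by positivity)
        have h2 : 1 / (t * κ) ≤ 1 / t :=
          one_div_le_one_div_of_le ht (by nlinarith)
        have h3 : 0 < 1 / (t * κ) := by positivity
        have h4 : 1 / (t * κ) * p ≤ 1 / t * (N * (θ * u)) :=
          (mul_le_mul_of_nonneg_left hpi h3.le).trans (mul_le_mul_of_nonneg_right h2 hNθ)
        have h5 := hsmall i hi hiL
        have h6 : θ * u ≤ N * (θ * u) := by nlinarith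
        have h7 := mul_nonneg hNθ ht'.le
        rw [h1, hES]
        nlinarith
      · have : 0 ≤ (x i / y) ^ 2 * (-p2) := mul_nonneg (sq_nonneg _) (by linarith)
        have h2 : 2 * (t * κ) * ξ i ^ 2 / y = t * κ * (2 * ξ i ^ 2 / y) := by ring
        linarith
  choose! X Y hX hY hXY hXle hYle using key
  have hcs := Finset.sum_sq_le_sum_mul_sum_of_sq_le_mul S hX hY hXY
  rw [← h.quotD_eq_sum] at hcs
  have hEL0 : 0 ≤ EL := by rw [hEL]; positivity
  have hES0 : 0 ≤ ES := by rw [hES]; positivity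
  have hite : ∀ a b : ι → ℝ, ∑ i ∈ S, (if i ∈ L then a i else b i)
      = ∑ i ∈ S \ L, b i + ∑ i ∈ L, a i := by
    intro a b
    rw [← Finset.sum_sdiff hLS]
    congr 1
    · exact Finset.sum_congr rfl fun i hi => by simp [(Finset.mem_sdiff.1 hi).2]
    · exact Finset.sum_congr rfl fun i hi => by simp [hi]
  have hm2 : (0 : ℝ) < (m : ℝ) + 2 := by positivity
  have hmK : (m : ℝ) + 2 = K + L.card := by exact_mod_cast hm
  have hXs : ∑ i ∈ S, X i ≤ ((m : ℝ) + 2) * (c * (-esymmQuot x S (m + 1))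
      + (N ^ 2 + 2 * D * M) * θ * u * (1 + 1 / t)) := by
    refine (Finset.sum_le_sum hXle).trans ?_
    rw [Finset.sum_add_distrib, ← Finset.mul_sum, Finset.sum_neg_distrib, ← h.quot_eq_sum,
      hite (fun _ => EL) (fun _ => ES), Finset.sum_const, Finset.sum_const, nsmul_eq_mul,
      nsmul_eq_mul]
    have h1 : ((S \ L).card : ℝ) * ES ≤ N * ES := mul_le_mul_of_nonneg_right
      ((Nat.cast_le.2 (Finset.card_le_card Finset.sdiff_subset)).trans hN) hES0
    have h2 : (L.card : ℝ) * EL ≤ ((m : ℝ) + 2) * EL := mul_le_mul_of_nonneg_right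
      (by rw [hmK]; linarith [Nat.cast_nonneg (α := ℝ) K]) hEL0
    have h3 : N * ES ≤ ((m : ℝ) + 2) * (N * ES) := by
      have : 0 ≤ N * ES := by positivity
      nlinarith [Nat.cast_nonneg (α := ℝ) m]
    have h4 : (N ^ 2 + 2 * D * M) * θ * u * (1 + 1 / t) = N * ES + EL := by
      rw [hES, hEL]; ring
    rw [h4]
    linarith
  -- The large indices use tT once each and the small ones κ ≤ K times together; K + |L| = m + 2 is
  -- what makes the budget close.
  have hYs : ∑ i ∈ S, Y i ≤ ((m : ℝ) + 2) * (-esymmQuotDD x ξ S (m + 1) + t * T) := by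
    refine (Finset.sum_le_sum hYle).trans ?_
    rw [Finset.sum_add_distrib, hite (fun _ => t * T), Finset.sum_const, nsmul_eq_mul,
      ← Finset.mul_sum, ← hT']
    have h1 : ∑ i ∈ S, (2 * esymmCross x ξ S m i ^ 2 / esymmPivot x S m i
          + (x i / esymmPivot x S m i) ^ 2 * (-esymmQuotDD x ξ (S.erase i) m))
        = -(((m : ℝ) + 2) * esymmQuotDD x ξ S (m + 1)) := by
      rw [h.quotDD_eq_sum, ← Finset.sum_neg_distrib]
      exact Finset.sum_congr rfl fun i _ => by ring
    rw [h1]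
    have h2 : κ * (t * T) ≤ K * (t * T) :=
      mul_le_mul_of_nonneg_right hκK (mul_nonneg ht.le hT0)
    rw [mul_add, hmK]
    linarith
  have hXs0 := Finset.sum_nonneg hX
  have hYs0 := Finset.sum_nonneg hY
  set XX := c * (-esymmQuot x S (m + 1)) + (N ^ 2 + 2 * D * M) * θ * u * (1 + 1 / t)
  set YY := -esymmQuotDD x ξ S (m + 1) + t * T
  have hXX : 0 ≤ XX := nonneg_of_mul_nonneg_right (hXs0.trans hXs) hm2
  refine ⟨hXX, ?_⟩
  have h1 := hcs.trans (mul_le_mul hXs hYs hYs0 (mul_nonneg hm2.le hXX))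
  have h2 : ((m : ℝ) + 2) ^ 2 * esymmQuotD x ξ S (m + 1) ^ 2
      ≤ ((m : ℝ) + 2) ^ 2 * (XX * YY) := by nlinarith
  exact le_of_mul_le_mul_left h2 (by positivity)

end Core

/-! ### Induction on the number of large variables. -/

section Induction

variable {ι : Type*} [DecidableEq ι]

/-- A bound for the derivative of `σ_{m+2} / σ_{m+1}` by its second derivative and a weighted sum
of squares over the small variables, up to an error that is linear in the size `θ` of the small
variables. -/
theorem exists_quotD_sq_le {K : ℕ} (hK : 2 ≤ K) {N Θ ρ : ℝ} (hN1 : 1 ≤ N) (hΘ : 0 < Θ)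
    (hρ : 1 / 2 ≤ ρ) (hρ1 : ρ ≤ 1) (l : ℕ) (hκ : 1 ≤ K * ρ ^ l) :
    ∃ M : ℝ, 0 ≤ M ∧ ∀ (x ξ : ι → ℝ) (u θ : ℝ) (S L : Finset ι) (m : ℕ),
      0 < u → 0 ≤ θ → θ ≤ 1 → θ ≤ (1 - ρ) * Θ → L.card = l → m + 2 = K + l → L ⊆ S →
      (S.card : ℝ) ≤ N → InCone x S (m + 1) → (∀ i ∈ L, Θ * u ≤ x i) → (∀ i ∈ L, x i ≤ u) →
      (∀ j ∈ S, j ∉ L → x j ≤ θ * u) → -u ≤ esymmQuot x S (m + 1) → ∀ t : ℝ, 0 < t →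
      0 ≤ 1 / 2 * (1 + 1 / (t * (K * ρ ^ l))) * (-esymmQuot x S (m + 1))
        + M * θ * u * (1 + 1 / t) ∧
      esymmQuotD x ξ S (m + 1) ^ 2
        ≤ (1 / 2 * (1 + 1 / (t * (K * ρ ^ l))) * (-esymmQuot x S (m + 1))
          + M * θ * u * (1 + 1 / t))
          * (-esymmQuotDD x ξ S (m + 1) + t * (2 * ∑ j ∈ S \ L, ξ j ^ 2 *
            (esymmOn x (S.erase j) m / esymmOn x S (m + 1)))) := by
  have hKρ : ∀ l : ℕ, (K : ℝ) * ρ ^ l ≤ K := fun l =>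
    mul_le_of_le_one_right (Nat.cast_nonneg _) (pow_le_one₀ (by linarith) hρ1)
  induction l with
  | zero =>
    -- Without large variables the hypothesis on deletions is vacuous, so M = 0 and κ' are dummy
    -- values.
    refine ⟨N ^ 2 + 2 * (1 + ((K : ℝ) + N ^ 2) / Θ) * 0, by simpa using sq_nonneg N, ?_⟩
    intro x ξ u θ S L m hu hθ hθ1 hθΘ hL hm hLS hN h hlarge hxu hsmall hq t ht
    obtain rfl := Finset.card_eq_zero.1 hL
    have hmK : (K : ℝ) = (m : ℝ) + 2 := by
      have : (m : ℝ) + 2 = K + (0 : ℕ) := by exact_mod_cast hm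
      simpa using this.symm
    have := h.quotD_sq_le_step (ξ := ξ) (M := 0) (κ' := K * ρ ^ 0 / ρ) hK hΘ hρ hρ1 hu hθ hθ1
      hθΘ hκ (hKρ 0) (by field_simp) le_rfl ht (by simpa using hm) hLS hN1 hN hlarge hsmall hq
      (by simp)
    rw [← hmK] at this
    exact this
  | succ l ih =>
    have hρl : K * ρ ^ (l + 1) = ρ * (K * ρ ^ l) := by ring
    have hκ1 : 1 ≤ K * ρ ^ l := by
      have : 0 ≤ K * ρ ^ l := by positivity
      rw [hρl] at hκ
      nlinarith
    obtain ⟨M, hM, ih⟩ := ih hκ1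
    refine ⟨N ^ 2 + 2 * (1 + ((K : ℝ) + (l + 1 : ℕ) + N ^ 2) / Θ) * M, by positivity, ?_⟩
    intro x ξ u θ S L m hu hθ hθ1 hθΘ hL hm hLS hN h hlarge hxu hsmall hq t ht
    have hmK : (K : ℝ) + (l + 1 : ℕ) = (m : ℝ) + 2 := by exact_mod_cast hm.symm
    obtain ⟨m, rfl⟩ : ∃ m', m = m' + 1 := ⟨m - 1, by omega⟩
    rw [hmK]
    refine h.quotD_sq_le_step (κ' := K * ρ ^ l) hK hΘ hρ hρ1 hu hθ hθ1 hθΘ hκ (hKρ _) hρl hM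
      ht (by rw [hL]; exact hm) hLS hN1 hN hlarge hsmall hq fun i hi t ht => ?_
    have hiS := hLS hi
    have hpiv := h.pivot_pos hiS
    rw [esymmPivot] at hpiv
    have hsd : S.erase i \ L.erase i = S \ L := by
      ext j
      simp only [Finset.mem_sdiff, Finset.mem_erase]
      constructor
      · rintro ⟨⟨h1, h2⟩, h3⟩
        exact ⟨h2, fun hj => h3 ⟨h1, hj⟩⟩
      · rintro ⟨h1, h2⟩
        exact ⟨⟨fun hji => h2 (hji ▸ hi), h1⟩, fun hj => h2 hj.2⟩
    -- Deletion lowers m and l together and keeps K. The bound −u on the new quotient follows from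
    -- positivity of the pivot and x_i ≤ u.
    have := ih x ξ u θ (S.erase i) (L.erase i) m hu hθ hθ1 hθΘ
      (by rw [Finset.card_erase_of_mem hi]; omega) (by omega) (Finset.erase_subset_erase i hLS)
      ((Nat.cast_le.2 (Finset.card_le_card (Finset.erase_subset i S))).trans hN) (h.erase hiS)
      (fun j hj => hlarge j (Finset.mem_of_mem_erase hj))
      (fun j hj => hxu j (Finset.mem_of_mem_erase hj))
      (fun j hj hjL => hsmall j (Finset.mem_of_mem_erase hj) fun hj' =>
        hjL (Finset.mem_erase.2 ⟨Finset.ne_of_mem_erase hj, hj'⟩))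
      (by linarith [hxu i hi]) t ht
    rw [hsd] at this
    simpa using this

end Induction

/-! ### Second-order expansion in the largest variable. -/

section Assembly

variable {ι : Type*} [DecidableEq ι] {x ξ : ι → ℝ} {S : Finset ι} {m : ℕ} {i : ι}

/-- The second-order inequality for `σ_{m+2}` obtained by writing it as
`σ_{m+1}(x|i) * (x i + σ_{m+2}(x|i) / σ_{m+1}(x|i))`. -/
theorem InCone.second_order_ge (h : InCone x S (m + 2)) (hi : i ∈ S) :
    0 < x i + esymmQuot x (S.erase i) (m + 1) ∧
    (1 + 1 / ((m : ℝ) + 2)) * ((ξ i + esymmQuotD x ξ (S.erase i) (m + 1))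
        / (x i + esymmQuot x (S.erase i) (m + 1))) ^ 2
      - esymmQuotDD x ξ (S.erase i) (m + 1) / (x i + esymmQuot x (S.erase i) (m + 1))
      ≤ -(esymmOnDD x ξ S (m + 2) / esymmOn x S (m + 2))
        + 2 * (esymmOnD x ξ S (m + 2) ^ 2 / esymmOn x S (m + 2) ^ 2) := by
  have hc := h.erase hi
  have hA := hc (m + 1) le_rfl
  have hpos : 0 < x i + esymmQuot x (S.erase i) (m + 1) := h.pivot_pos hi
  refine ⟨hpos, ?_⟩
  have hconc := hc.esymmOnDD_mul_le (ξ := ξ)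
  rw [esymmOnD_succ x ξ hi (m + 1), esymmOnDD_succ x ξ hi (m + 1), esymmOnD_eq_quot hA.ne',
    esymmOnDD_eq_quot hA.ne', esymmOn_eq_pivot_mul hi hA.ne', esymmPivot]
  set A := esymmOn x (S.erase i) (m + 1)
  set b := esymmOnD x ξ (S.erase i) (m + 1)
  set c := esymmOnDD x ξ (S.erase i) (m + 1)
  set q := esymmQuot x (S.erase i) (m + 1)
  set q1 := esymmQuotD x ξ (S.erase i) (m + 1)
  set q2 := esymmQuotDD x ξ (S.erase i) (m + 1)
  set w := b / A with hwd
  set z := (ξ i + q1) / (x i + q) with hz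
  have hm1 : (0 : ℝ) < (m : ℝ) + 1 := by positivity
  have hcA : c / A ≤ m / ((m : ℝ) + 1) * w ^ 2 := by
    rw [hwd, div_pow, div_mul_div_comm, div_le_div_iff₀ hA (by positivity)]
    nlinarith
  have e1 : (2 * ξ i * b + x i * c + (q2 * A + 2 * q1 * b + q * c)) / ((x i + q) * A)
      = q2 / (x i + q) + 2 * z * w + c / A := by
    rw [hz, hwd]
    field_simp
    ring
  have e2 : (ξ i * A + x i * b + (q1 * A + q * b)) ^ 2 / ((x i + q) * A) ^ 2 = (z + w) ^ 2 := by
    rw [← div_pow, hz, hwd]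
    congr 1
    field_simp
    ring
  rw [e1, e2]
  -- Minimisation over the logarithmic derivative w of A: completing the square leaves 2 −
  -- (m+1)/(m+2) = 1 + 1/(m+2) in front of z².
  have e3 : -(q2 / (x i + q) + 2 * z * w + m / ((m : ℝ) + 1) * w ^ 2) + 2 * (z + w) ^ 2
      - ((1 + 1 / ((m : ℝ) + 2)) * z ^ 2 - q2 / (x i + q))
      = (((m : ℝ) + 2) * w + ((m : ℝ) + 1) * z) ^ 2 / (((m : ℝ) + 1) * ((m : ℝ) + 2)) := by
    field_simp
    ring
  have h4 : 0 ≤ (((m : ℝ) + 2) * w + ((m : ℝ) + 1) * z) ^ 2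
      / (((m : ℝ) + 1) * ((m : ℝ) + 2)) := by positivity
  linarith

/-- The weighted squares of the small variables, compared with the first derivatives of
`σ_{m+2}`. -/
theorem InCone.sum_sq_le {L : Finset ι} {θ δ u : ℝ} (h : InCone x S (m + 2)) (hi : i ∈ S)
    (hu : 0 < u) (hxi : x i = u) (hxu : ∀ j ∈ S, x j ≤ u)
    (hsmall : ∀ j ∈ S.erase i, j ∉ L → x j ≤ θ * u) (hδ : 0 ≤ δ)
    (hδθ : 3 / 4 * (1 + 2 * δ) ≤ 1 - θ) :
    3 / 4 * (2 * ∑ j ∈ S.erase i \ L, ξ j ^ 2 * (esymmOn x ((S.erase i).erase j) m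
        / esymmOn x (S.erase i) (m + 1))) / (u + esymmQuot x (S.erase i) (m + 1))
      ≤ 2 * ∑ j ∈ S.erase i, esymmOn x (S.erase j) (m + 1) * ξ j ^ 2
        / ((1 + 2 * δ) * u * esymmOn x S (m + 2)) := by
  have hc := h.erase hi
  have hA := hc (m + 1) le_rfl
  have hpos : 0 < u + esymmQuot x (S.erase i) (m + 1) := hxi ▸ h.pivot_pos hi
  have hf : esymmOn x S (m + 2)
      = (u + esymmQuot x (S.erase i) (m + 1)) * esymmOn x (S.erase i) (m + 1) := by
    rw [esymmOn_eq_pivot_mul hi hA.ne', esymmPivot, hxi]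
  have hd : ∀ j ∈ S.erase i, 0 < esymmOn x ((S.erase i).erase j) m ∧
      (u - x j) * esymmOn x ((S.erase i).erase j) m ≤ esymmOn x (S.erase j) (m + 1) := by
    intro j hj
    have hji := Finset.ne_of_mem_erase hj
    have hiS : i ∈ S.erase j := Finset.mem_erase.2 ⟨hji.symm, hi⟩
    have hp := (hc.erase hj) m le_rfl
    have e1 := esymmOn_succ x hj m
    have e2 := esymmOn_succ x hiS m
    rw [Finset.erase_right_comm, hxi] at e2
    exact ⟨hp, by nlinarith⟩
  have hnn : ∀ j ∈ S.erase i, 0 ≤ esymmOn x (S.erase j) (m + 1) * ξ j ^ 2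
        / ((1 + 2 * δ) * u * esymmOn x S (m + 2)) := by
    intro j hj
    obtain ⟨h1, h2⟩ := hd j hj
    have h3 : 0 ≤ (u - x j) * esymmOn x ((S.erase i).erase j) m :=
      mul_nonneg (by linarith [hxu j (Finset.mem_of_mem_erase hj)]) h1.le
    have h4 := h (m + 2) le_rfl
    have h5 := h3.trans h2
    positivity
  calc _ = 2 * ∑ j ∈ S.erase i \ L, (3 / 4 * (ξ j ^ 2 * (esymmOn x ((S.erase i).erase j) m
        / esymmOn x (S.erase i) (m + 1))) / (u + esymmQuot x (S.erase i) (m + 1))) := by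
        rw [← Finset.sum_div, ← Finset.mul_sum]
        ring
    _ ≤ 2 * ∑ j ∈ S.erase i \ L, esymmOn x (S.erase j) (m + 1) * ξ j ^ 2
        / ((1 + 2 * δ) * u * esymmOn x S (m + 2)) := by
        refine mul_le_mul_of_nonneg_left (Finset.sum_le_sum fun j hj => ?_) zero_le_two
        rw [Finset.mem_sdiff] at hj
        obtain ⟨h1, h2⟩ := hd j hj.1
        have h3 := hsmall j hj.1 hj.2
        rw [hf]
        set E := esymmOn x ((S.erase i).erase j) m
        set A := esymmOn x (S.erase i) (m + 1)
        set G := esymmOn x (S.erase j) (m + 1)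
        set n := u + esymmQuot x (S.erase i) (m + 1)
        have h4 : 3 / 4 * ((1 + 2 * δ) * u) * E ≤ G := by
          refine le_trans (mul_le_mul_of_nonneg_right ?_ h1.le) h2
          nlinarith [mul_le_mul_of_nonneg_right hδθ hu.le]
        have e : 3 / 4 * (ξ j ^ 2 * (E / A)) / n
            = 3 / 4 * ((1 + 2 * δ) * u) * E * ξ j ^ 2 / ((1 + 2 * δ) * u * (n * A)) := by
          field_simp
        rw [e]
        exact div_le_div_of_nonneg_right (mul_le_mul_of_nonneg_right h4 (sq_nonneg _))
          (by positivity)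
    _ ≤ _ := by
        refine mul_le_mul_of_nonneg_left ?_ zero_le_two
        exact Finset.sum_le_sum_of_subset_of_nonneg Finset.sdiff_subset fun j hj _ => hnn j hj

/-- Weighted convexity of the square. -/
theorem sq_le_of_add {ζ q₁ a b Y X R : ℝ} (ha : 0 < a) (hX : 0 ≤ X) (hY : 0 ≤ Y)
    (hq : q₁ ^ 2 ≤ X * Y) (hab : 0 < b) (hR : b * (a + X) ≤ R) :
    b * ζ ^ 2 ≤ R * ((ζ + q₁) ^ 2 / a + Y) := by
  have h1 : ζ ^ 2 ≤ (a + X) * ((ζ + q₁) ^ 2 / a + Y) := by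
    have := cauchy_two (a := ζ + q₁) (b := -q₁) (A := a) (B := (ζ + q₁) ^ 2 / a) (X := X) (C := Y)
      ha.le (by positivity) hX hY (le_of_eq (by field_simp)) (by simpa using hq)
    simpa using this
  have h2 : 0 ≤ (ζ + q₁) ^ 2 / a + Y := by positivity
  calc b * ζ ^ 2 ≤ b * ((a + X) * ((ζ + q₁) ^ 2 / a + Y)) := mul_le_mul_of_nonneg_left h1 hab.le
    _ = (b * (a + X)) * ((ζ + q₁) ^ 2 / a + Y) := by ring
    _ ≤ _ := mul_le_mul_of_nonneg_right hR h2

end Assembly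

/-! ### Numerical constants and the choice of the threshold θ. -/

section Thresholds

/-- Up to E, the bracket is affine in q: about uk/(k+1) at q = 0 and cu ≤ 7u/8 at q = −u. Both leave
room for the factor 1 + 1/(1+16k). -/
theorem final_coefficient_le {k u q c E P : ℝ} (hk : 2 ≤ k) (hu : 0 < u) (hq : -u ≤ q)
    (hqP : q ≤ P) (hP : 0 ≤ P) (hc : 1 / 2 ≤ c) (hc' : c ≤ 7 / 8)
    (hE : E + P ≤ u / (4 * (k + 1))) :
    (1 + 1 / (1 + 16 * k)) * ((u + q) * (k / (k + 1)) + (c * (-q) + E)) ≤ u := by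
  have hk1 : 0 < k + 1 := by linarith
  have hk2 : 0 < 1 + 16 * k := by linarith
  have hb : 1 + 1 / (1 + 16 * k) = (16 * k + 2) / (16 * k + 1) := by
    field_simp
    ring
  have h16 : 0 < 16 * k + 1 := by linarith
  rw [hb, div_mul_eq_mul_div, div_le_iff₀ h16]
  set r := 1 / (k + 1) with hr
  have hrk : k / (k + 1) = 1 - r := by rw [hr]; field_simp; ring
  have hr0 : 0 < r := by positivity
  have hr3 : r ≤ 1 / 3 := one_div_le_one_div_of_le (by norm_num) (by linarith)
  have hrk1 : r * (k + 1) = 1 := by rw [hr]; field_simp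
  have hE' : E + P ≤ u * r / 4 := by
    refine hE.trans (le_of_eq ?_)
    rw [hr]; field_simp
  rw [hrk]
  have hmain : (u + q) * (1 - r) + (c * (-q) + E) ≤ u - u * r / 4 - u * r / 2 ∨
      (u + q) * (1 - r) + (c * (-q) + E) ≤ u - u * (1 / 8) + u * r / 4 := by
    rcases le_total q 0 with h0 | h0
    · rcases le_total r (1 / 8) with h8 | h8
      · left
        nlinarith
      · right
        nlinarith
    · left
      nlinarith
  have hkr : k * r = 1 - r := by linarith
  -- Tangent line of 1/(k+1) at k = 2, where the second alternative is tightest.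
  have hrt : 1 / 3 - (k - 2) / 9 ≤ r := by
    rw [hr, le_div_iff₀ hk1]
    nlinarith [sq_nonneg (k - 2)]
  rcases hmain with h | h
  · have h1 : (16 * k + 2) * (1 - r / 4 - r / 2) ≤ 16 * k + 1 := by
      linarith
    calc _ ≤ (16 * k + 2) * (u - u * r / 4 - u * r / 2) :=
          mul_le_mul_of_nonneg_left h (by linarith)
      _ = u * ((16 * k + 2) * (1 - r / 4 - r / 2)) := by ring
      _ ≤ _ := mul_le_mul_of_nonneg_left h1 hu.le
  · have h1 : (16 * k + 2) * (7 / 8 + r / 4) ≤ 16 * k + 1 := by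
      linarith
    calc _ ≤ (16 * k + 2) * (u - u * (1 / 8) + u * r / 4) :=
          mul_le_mul_of_nonneg_left h (by linarith)
      _ = u * ((16 * k + 2) * (7 / 8 + r / 4)) := by ring
      _ ≤ _ := mul_le_mul_of_nonneg_left h1 hu.le

variable {ι : Type*} [DecidableEq ι]

/-- The concavity inequality, given a bound for the derivative of `σ_{m+2}(x|i) / σ_{m+1}(x|i)`. -/
theorem InCone.concavity_of_quotD_sq_le {x ξ : ι → ℝ} {S L : Finset ι} {i : ι} {m : ℕ}
    {u δ θ c E P : ℝ} (h : InCone x S (m + 2)) (hi : i ∈ S) (hxi : x i = u) (hu : 0 < u)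
    (hxu : ∀ j ∈ S, x j ≤ u) (hsmall : ∀ j ∈ S.erase i, j ∉ L → x j ≤ θ * u) (hδ : 0 ≤ δ)
    (hδθ : 3 / 4 * (1 + 2 * δ) ≤ 1 - θ)
    (hqP : esymmQuot x (S.erase i) (m + 1) ≤ P) (hP : 0 ≤ P) (hc : 1 / 2 ≤ c) (hc' : c ≤ 7 / 8)
    (hE : E + P ≤ u / (4 * (((m : ℝ) + 2) + 1)))
    (hX : 0 ≤ c * (-esymmQuot x (S.erase i) (m + 1)) + E)
    (hq1 : esymmQuotD x ξ (S.erase i) (m + 1) ^ 2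
      ≤ (c * (-esymmQuot x (S.erase i) (m + 1)) + E)
        * (-esymmQuotDD x ξ (S.erase i) (m + 1) + 3 / 4 * (2 * ∑ j ∈ S.erase i \ L, ξ j ^ 2 *
          (esymmOn x ((S.erase i).erase j) m / esymmOn x (S.erase i) (m + 1))))) :
    (1 + 1 / (1 + 16 * ((m : ℝ) + 2)))
        * (esymmOn x (S.erase i) (m + 1) * ξ i ^ 2 / (u * esymmOn x S (m + 2)))
      ≤ -(esymmOnDD x ξ S (m + 2) / esymmOn x S (m + 2))
        + 2 * (esymmOnD x ξ S (m + 2) ^ 2 / esymmOn x S (m + 2) ^ 2)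
        + 2 * ∑ j ∈ S.erase i, esymmOn x (S.erase j) (m + 1) * ξ j ^ 2
          / ((1 + 2 * δ) * u * esymmOn x S (m + 2)) := by
  have hC := h.erase hi
  have hA := hC (m + 1) le_rfl
  obtain ⟨hpos, hso⟩ := h.second_order_ge (ξ := ξ) hi
  have hth := h.sum_sq_le (ξ := ξ) hi hu hxi hxu hsmall hδ hδθ
  rw [hxi] at hpos hso
  have hdd := hC.quotDD_nonpos (ξ := ξ)
  have hT0 : 0 ≤ ∑ j ∈ S.erase i \ L, ξ j ^ 2 *
      (esymmOn x ((S.erase i).erase j) m / esymmOn x (S.erase i) (m + 1)) :=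
    Finset.sum_nonneg fun j hj => mul_nonneg (sq_nonneg _)
      (div_nonneg ((hC.erase (Finset.mem_sdiff.1 hj).1) m le_rfl).le hA.le)
  have hf : esymmOn x S (m + 2)
      = (u + esymmQuot x (S.erase i) (m + 1)) * esymmOn x (S.erase i) (m + 1) := by
    rw [esymmOn_eq_pivot_mul hi hA.ne', esymmPivot, hxi]
  refine le_trans ?_ (add_le_add hso hth)
  rw [hf]
  generalize ∑ j ∈ S.erase i \ L, ξ j ^ 2 *
    (esymmOn x ((S.erase i).erase j) m / esymmOn x (S.erase i) (m + 1)) = T at hT0 hq1 ⊢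
  generalize esymmQuot x (S.erase i) (m + 1) = q at hqP hX hq1 hpos ⊢
  generalize esymmQuotD x ξ (S.erase i) (m + 1) = q1 at hq1 ⊢
  generalize esymmQuotDD x ξ (S.erase i) (m + 1) = q2 at hq1 hdd ⊢
  generalize esymmOn x (S.erase i) (m + 1) = A at hA ⊢
  have hcoef := final_coefficient_le (k := (m : ℝ) + 2) (q := q) (c := c) (E := E)
    (P := P) (by linarith [Nat.cast_nonneg (α := ℝ) m]) hu (by linarith) hqP hP hc hc' hE
  have hfin := sq_le_of_add (ζ := ξ i) (a := (u + q) * (((m : ℝ) + 2) / ((m : ℝ) + 2 + 1)))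
    (b := 1 + 1 / (1 + 16 * ((m : ℝ) + 2))) (R := u) (by positivity) hX
    (by linarith) hq1 (by positivity) hcoef
  have e1 : (1 + 1 / (1 + 16 * ((m : ℝ) + 2))) * (A * ξ i ^ 2 / (u * ((u + q) * A)))
      = (1 + 1 / (1 + 16 * ((m : ℝ) + 2))) * ξ i ^ 2 / (u * (u + q)) := by
    field_simp
  have e2 : (1 + 1 / ((m : ℝ) + 2)) * ((ξ i + q1) / (u + q)) ^ 2 - q2 / (u + q)
        + 3 / 4 * (2 * T) / (u + q)
      = u * ((ξ i + q1) ^ 2 / ((u + q) * (((m : ℝ) + 2) / ((m : ℝ) + 2 + 1)))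
        + (-q2 + 3 / 4 * (2 * T))) / (u * (u + q)) := by
    field_simp
    ring
  rw [e1, e2]
  exact div_le_div_of_nonneg_right hfin (by positivity)

/-- The concavity inequality holds as soon as the variables split into large ones, of size at
least `Θ u`, and sufficiently small ones, of size at most `θ u`. -/
theorem exists_threshold {N m : ℕ} (hmN : m + 2 ≤ N) {Θ : ℝ} (hΘ : 0 < Θ) :
    ∃ θ : ℝ, 0 < θ ∧ θ ≤ Θ ∧ ∀ (x ξ : ι → ℝ) (S L : Finset ι) (i : ι) (u δ : ℝ),
      S.card ≤ N → i ∈ S → x i = u → 0 < u → L ⊆ S.erase i → L.card ≤ m →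
      InCone x S (m + 2) → (∀ j ∈ S, x j ≤ u) → (∀ j ∈ L, Θ * u ≤ x j) →
      (∀ j ∈ S.erase i, j ∉ L → x j ≤ θ * u) → 0 ≤ δ → δ ≤ 1 / 20 →
      (1 + 1 / (1 + 16 * ((m : ℝ) + 2)))
          * (esymmOn x (S.erase i) (m + 1) * ξ i ^ 2 / (u * esymmOn x S (m + 2)))
        ≤ -(esymmOnDD x ξ S (m + 2) / esymmOn x S (m + 2))
          + 2 * (esymmOnD x ξ S (m + 2) ^ 2 / esymmOn x S (m + 2) ^ 2)
          + 2 * ∑ j ∈ S.erase i, esymmOn x (S.erase j) (m + 1) * ξ j ^ 2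
            / ((1 + 2 * δ) * u * esymmOn x S (m + 2)) := by
  have hN0 : (0 : ℝ) < (N : ℝ) + 1 := by positivity
  have hmN' : (m : ℝ) + 2 ≤ N := by exact_mod_cast hmN
  have hN1 : (1 : ℝ) ≤ N := by linarith [Nat.cast_nonneg (α := ℝ) m]
  -- By Bernoulli ρ^l ≥ 8/9, so κ = Kρ^l ≥ 16/9 for K ≥ 2. With t = 3/4 this gives tκ ≥ 4/3 and c ≤
  -- 7/8.
  set ρ : ℝ := 1 - 1 / (9 * ((N : ℝ) + 1)) with hρd
  have hfrac : 1 / (9 * ((N : ℝ) + 1)) ≤ 1 / 9 :=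
    one_div_le_one_div_of_le (by norm_num) (by linarith)
  have hfrac0 : 0 < 1 / (9 * ((N : ℝ) + 1)) := by positivity
  have hρ : 1 / 2 ≤ ρ := by linarith
  have hρ1 : ρ ≤ 1 := by linarith
  have hpow : ∀ l ≤ m, 8 / 9 ≤ ρ ^ l := by
    intro l hl
    have h1 := one_add_mul_le_pow (a := -(1 / (9 * ((N : ℝ) + 1)))) (by linarith) l
    have h2 : (l : ℝ) * (1 / (9 * ((N : ℝ) + 1))) ≤ 1 / 9 := by
      have : (l : ℝ) ≤ (N : ℝ) + 1 := by
        have : (l : ℝ) ≤ m := by exact_mod_cast hl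
        linarith
      rw [mul_one_div, div_le_div_iff₀ (by positivity) (by norm_num)]
      linarith
    rw [← sub_eq_add_neg] at h1
    linarith
  have hK : ∀ l ≤ m, (2 : ℝ) ≤ ((m + 2 - l : ℕ) : ℝ) := by
    intro l hl
    exact_mod_cast (by omega : 2 ≤ m + 2 - l)
  have hκ : ∀ l ≤ m, 16 / 9 ≤ ((m + 2 - l : ℕ) : ℝ) * ρ ^ l := by
    intro l hl
    nlinarith [hK l hl, hpow l hl]
  have hM : ∀ l : ℕ, ∃ M : ℝ, 0 ≤ M ∧ (l ≤ m → ∀ (x ξ : ι → ℝ) (u θ : ℝ) (S L : Finset ι) (m' : ℕ),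
      0 < u → 0 ≤ θ → θ ≤ 1 → θ ≤ (1 - ρ) * Θ → L.card = l → m' + 2 = (m + 2 - l) + l → L ⊆ S →
      (S.card : ℝ) ≤ N → InCone x S (m' + 1) → (∀ i ∈ L, Θ * u ≤ x i) → (∀ i ∈ L, x i ≤ u) →
      (∀ j ∈ S, j ∉ L → x j ≤ θ * u) → -u ≤ esymmQuot x S (m' + 1) → ∀ t : ℝ, 0 < t →
      0 ≤ 1 / 2 * (1 + 1 / (t * (((m + 2 - l : ℕ) : ℝ) * ρ ^ l))) * (-esymmQuot x S (m' + 1))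
        + M * θ * u * (1 + 1 / t) ∧
      esymmQuotD x ξ S (m' + 1) ^ 2
        ≤ (1 / 2 * (1 + 1 / (t * (((m + 2 - l : ℕ) : ℝ) * ρ ^ l))) * (-esymmQuot x S (m' + 1))
          + M * θ * u * (1 + 1 / t))
          * (-esymmQuotDD x ξ S (m' + 1) + t * (2 * ∑ j ∈ S \ L, ξ j ^ 2 *
            (esymmOn x (S.erase j) m' / esymmOn x S (m' + 1))))) := by
    intro l
    by_cases hl : l ≤ m
    · obtain ⟨M, hM, h⟩ := exists_quotD_sq_le (ι := ι) (K := m + 2 - l) (by omega) hN1 hΘ hρ hρ1 l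
        (by linarith [hκ l hl])
      exact ⟨M, hM, fun _ => h⟩
    · exact ⟨0, le_rfl, fun h => absurd h hl⟩
  choose M hM0 hM using hM
  set B : ℝ := ∑ l ∈ Finset.range (m + 1), M l with hB
  have hB0 : 0 ≤ B := Finset.sum_nonneg fun l _ => hM0 l
  have hMB : ∀ l ≤ m, M l ≤ B := fun l hl =>
    Finset.single_le_sum (fun l _ => hM0 l) (Finset.mem_range.2 (by omega))
  -- Makes the total error (7/3·B + N)θu at most u/(4(N+1)), where 7/3 = 1 + 1/t at t = 3/4.
  set θ₁ : ℝ := 1 / (4 * ((N : ℝ) + 1) * (7 / 3 * B + N)) with hθ₁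
  have hBN : 0 < 7 / 3 * B + N := by linarith
  have hθ₁0 : 0 < θ₁ := by positivity
  have h1ρ : 1 - ρ = 1 / (9 * ((N : ℝ) + 1)) := by rw [hρd]; ring
  refine ⟨min (min (1 / 10) θ₁) ((1 - ρ) * Θ), ?_, ?_, ?_⟩
  · rw [h1ρ]
    exact lt_min (lt_min (by norm_num) hθ₁0) (by positivity)
  · refine (min_le_right _ _).trans ?_
    rw [h1ρ]
    nlinarith
  intro x ξ S L i u δ hS hi hxi hu hLS hLm h hxu hlarge hsmall hδ hδ1
  set θ := min (min (1 / 10) θ₁) ((1 - ρ) * Θ) with hθ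
  have hθ0 : 0 < θ := by
    rw [hθ, h1ρ]
    exact lt_min (lt_min (by norm_num) hθ₁0) (by positivity)
  have hθ10 : θ ≤ 1 / 10 := (min_le_left _ _).trans (min_le_left _ _)
  have hθθ₁ : θ ≤ θ₁ := (min_le_left _ _).trans (min_le_right _ _)
  have hθΘ : θ ≤ (1 - ρ) * Θ := min_le_right _ _
  have hc := h.erase hi
  have hA := hc (m + 1) le_rfl
  have hpos : 0 < esymmPivot x S (m + 1) i := h.pivot_pos hi
  rw [esymmPivot, hxi] at hpos
  have hcardN : ((S.erase i).card : ℝ) ≤ N := by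
    exact_mod_cast (Finset.card_le_card (Finset.erase_subset i S)).trans hS
  have hθu : 0 < θ * u := by positivity
  have hqle := hc.quot_le hθu.le hLS (by omega)
    (fun j hj => (by positivity : 0 < Θ * u).trans_le (hlarge j hj)) hsmall hcardN
  obtain ⟨hX, hq1⟩ := hM L.card hLm x ξ u θ (S.erase i) L m hu hθ0.le (by linarith) hθΘ rfl
    (by omega) hLS hcardN hc hlarge (fun j hj => hxu j (Finset.mem_of_mem_erase (hLS hj)))
    hsmall (by linarith) (3 / 4) (by norm_num)
  have hκL := hκ L.card hLm
  have hMl := hMB L.card hLm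
  set c : ℝ := 1 / 2 * (1 + 1 / (3 / 4 * (((m + 2 - L.card : ℕ) : ℝ) * ρ ^ L.card))) with hcd
  set E : ℝ := M L.card * θ * u * (1 + 1 / (3 / 4)) with hE
  have hκ0 : 0 < ((m + 2 - L.card : ℕ) : ℝ) * ρ ^ L.card := by linarith
  have hc1 : 1 / 2 ≤ c := by
    have : 0 < 1 / (3 / 4 * (((m + 2 - L.card : ℕ) : ℝ) * ρ ^ L.card)) :=
      one_div_pos.2 (by linarith)
    linarith
  have hc2 : c ≤ 7 / 8 := by
    have : 1 / (3 / 4 * (((m + 2 - L.card : ℕ) : ℝ) * ρ ^ L.card)) ≤ 3 / 4 := by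
      rw [div_le_iff₀ (by linarith)]
      linarith
    linarith
  have hEP : E + N * (θ * u) ≤ u / (4 * (((m : ℝ) + 2) + 1)) := by
    have h1 : E + N * (θ * u) ≤ (7 / 3 * B + N) * (θ * u) := by
      have : M L.card * (θ * u) ≤ B * (θ * u) := mul_le_mul_of_nonneg_right hMl hθu.le
      rw [hE]
      linarith
    have h2 : (7 / 3 * B + N) * (θ * u) ≤ (7 / 3 * B + N) * (θ₁ * u) :=
      mul_le_mul_of_nonneg_left (mul_le_mul_of_nonneg_right hθθ₁ hu.le) hBN.le
    have h3 : (7 / 3 * B + N) * (θ₁ * u) = u / (4 * ((N : ℝ) + 1)) := by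
      rw [hθ₁]; field_simp
    have h4 : u / (4 * ((N : ℝ) + 1)) ≤ u / (4 * (((m : ℝ) + 2) + 1)) :=
      div_le_div_of_nonneg_left hu.le (by positivity) (by linarith)
    linarith
  exact h.concavity_of_quotD_sq_le hi hxi hu hxu hsmall hδ (by linarith) hqle (by positivity)
    hc1 hc2 hEP hX hq1

end Thresholds

/-! ### Formal partial derivatives as σ's with deleted variables. -/

section PartialDerivatives

open MvPolynomial

theorem pderiv_esymmOn_eq_zero {ι : Type*} [DecidableEq ι] {S : Finset ι} {i : ι} (hi : i ∉ S)
    (j : ℕ) : pderiv i (esymmOn (X : ι → MvPolynomial ι ℝ) S j) = 0 := by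
  induction S using Finset.induction_on generalizing j with
  | empty => cases j <;> simp
  | insert p S hp ih =>
    have hip : p ≠ i := fun h => hi (h ▸ Finset.mem_insert_self p S)
    have hiS : i ∉ S := fun h => hi (Finset.mem_insert_of_mem h)
    cases j with
    | zero => simp
    | succ j =>
      rw [esymmOn_insert _ hp, map_add, Derivation.leibniz, ih hiS, ih hiS,
        pderiv_X_of_ne hip]
      simp

theorem pderiv_esymmOn {ι : Type*} [DecidableEq ι] {S : Finset ι} {i : ι} (hi : i ∈ S)
    (j : ℕ) : pderiv i (esymmOn (X : ι → MvPolynomial ι ℝ) S (j + 1))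
      = esymmOn X (S.erase i) j := by
  rw [esymmOn_succ _ hi, map_add, Derivation.leibniz,
    pderiv_esymmOn_eq_zero (Finset.notMem_erase i S),
    pderiv_esymmOn_eq_zero (Finset.notMem_erase i S), pderiv_X_self]
  simp

theorem eval_esymmOn {ι : Type*} (x : ι → ℝ) (S : Finset ι) (j : ℕ) :
    eval x (esymmOn (X : ι → MvPolynomial ι ℝ) S j) = esymmOn x S j := by
  simp [esymmOn]

theorem sigma_eq_esymmOn (n k : ℕ) (x : Fin n → ℝ) :
    sigma n k x = esymmOn x Finset.univ k := by
  rw [← eval_esymmOn]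
  rfl

theorem sigmaD_eq_esymmOn (n k : ℕ) (i : Fin n) (x : Fin n → ℝ) :
    sigmaD n (k + 1) i x = esymmOn x (Finset.univ.erase i) k := by
  rw [← eval_esymmOn, ← pderiv_esymmOn (Finset.mem_univ i)]
  rfl

theorem sigmaDD_eq_esymmOn (n k : ℕ) {p q : Fin n} (hpq : q ≠ p) (x : Fin n → ℝ) :
    sigmaDD n (k + 2) p q x = esymmOn x ((Finset.univ.erase p).erase q) k := by
  rw [← eval_esymmOn, Finset.erase_right_comm,
    ← pderiv_esymmOn (Finset.mem_erase.2 ⟨hpq.symm, Finset.mem_univ p⟩),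
    ← pderiv_esymmOn (Finset.mem_univ q)]
  rfl

end PartialDerivatives

/-! ### Lower bound for σ_k with k large entries. -/

section LowerBound

variable {ι : Type*} [DecidableEq ι]

/-- A product with a negative factor has one factor of modulus at most δu and all others of modulus
at most u, as δ ≤ 1. -/
theorem prod_ge_of_ge_neg {x : ι → ℝ} {u δ : ℝ} (hu : 0 < u) (hδ : 0 ≤ δ) (hδ1 : δ ≤ 1)
    (hlo : ∀ i, -δ * u ≤ x i) (hxu : ∀ i, x i ≤ u) (T : Finset ι) :
    -(δ * u ^ T.card) ≤ ∏ i ∈ T, x i := by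
  by_cases hT : ∀ i ∈ T, 0 ≤ x i
  · have : 0 ≤ δ * u ^ T.card := by positivity
    linarith [Finset.prod_nonneg hT]
  · push Not at hT
    obtain ⟨i, hi, hxi⟩ := hT
    have habs : |∏ j ∈ T.erase i, x j| ≤ u ^ (T.erase i).card := by
      rw [Finset.abs_prod]
      rw [← Finset.prod_const]
      refine Finset.prod_le_prod (fun j _ => abs_nonneg _) fun j _ => abs_le.2 ⟨?_, hxu j⟩
      nlinarith [hlo j]
    have hpow : u ^ T.card = u * u ^ (T.erase i).card := by
      rw [← Finset.card_erase_add_one hi, pow_succ]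
      ring
    have h1 : |x i| ≤ δ * u := by
      rw [abs_of_neg hxi]
      linarith [hlo i]
    have h2 : |∏ j ∈ T, x j| ≤ δ * u ^ T.card := by
      rw [← Finset.mul_prod_erase T x hi, abs_mul, hpow, ← mul_assoc]
      exact mul_le_mul h1 habs (abs_nonneg _) (by positivity)
    exact (abs_le.1 h2).1

/-- If `k` of the variables are at least `τ u` and none is below `-δ u`, then `σ_k` is bounded
below by a multiple of `u ^ k`. -/
theorem esymmOn_ge {x : ι → ℝ} {u δ τ : ℝ} (hu : 0 < u) (hδ : 0 ≤ δ) (hδ1 : δ ≤ 1)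
    (hτ : 0 ≤ τ) (hlo : ∀ i, -δ * u ≤ x i) (hxu : ∀ i, x i ≤ u) {S T : Finset ι} (hTS : T ⊆ S)
    (hT : ∀ i ∈ T, τ * u ≤ x i) :
    (τ ^ T.card - 2 ^ S.card * δ) * u ^ T.card ≤ esymmOn x S T.card := by
  have hmem : T ∈ S.powersetCard T.card := Finset.mem_powersetCard.2 ⟨hTS, rfl⟩
  rw [esymmOn, ← Finset.add_sum_erase _ _ hmem]
  have h1 : (τ * u) ^ T.card ≤ ∏ i ∈ T, x i := by
    rw [← Finset.prod_const]
    exact Finset.prod_le_prod (fun _ _ => by positivity) hT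
  have h2 : -(2 ^ S.card * (δ * u ^ T.card))
      ≤ ∑ U ∈ (S.powersetCard T.card).erase T, ∏ i ∈ U, x i := by
    have hcard : (((S.powersetCard T.card).erase T).card : ℝ) ≤ 2 ^ S.card := by
      have : ((S.powersetCard T.card).erase T).card ≤ S.powerset.card :=
        Finset.card_le_card fun U hU => Finset.mem_powerset.2
          (Finset.mem_powersetCard.1 (Finset.mem_of_mem_erase hU)).1
      rw [Finset.card_powerset] at this
      exact_mod_cast this
    calc -(2 ^ S.card * (δ * u ^ T.card))
        ≤ -(((S.powersetCard T.card).erase T).card * (δ * u ^ T.card)) :=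
          neg_le_neg (mul_le_mul_of_nonneg_right hcard (by positivity))
      _ = ∑ _U ∈ (S.powersetCard T.card).erase T, -(δ * u ^ T.card) := by simp
      _ ≤ _ := by
          refine Finset.sum_le_sum fun U hU => ?_
          have hUc := (Finset.mem_powersetCard.1 (Finset.mem_of_mem_erase hU)).2
          rw [← hUc]
          exact prod_ge_of_ge_neg hu hδ hδ1 hlo hxu U
  rw [mul_pow] at h1
  linarith

end LowerBound

/-! ### Locating the gap and concluding. -/

section Conclusion

/-- For fixed `s`, a vector with `σ_k = s`, large first entry and small negative part has fewer
than `k` entries comparable with the first one. -/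
theorem entry_lt_of_sigma_eq {n k : ℕ} (hk : 1 ≤ k) {τ s δ : ℝ} (hτ : 0 < τ)
    (hs : 0 < s) (hδ : 0 ≤ δ) (hδ1 : δ ≤ 1) (hδτ : 2 ^ n * δ ≤ τ ^ k / 2) {x : Fin n → ℝ}
    (hx : Antitone x) (hσ : sigma n k x = s) {first last j : Fin n} (hfirst : (first : ℕ) = 0)
    (hlast : (last : ℕ) + 1 = n) (hlo : -δ * x first ≤ x last)
    (hbig : 1 + 2 * s / τ ^ k ≤ x first) (hj : (j : ℕ) + 1 = k) : x j < τ * x first := by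
  by_contra! hc
  have hτk : 0 < τ ^ k := by positivity
  have hsτ : 0 < 2 * s / τ ^ k := by positivity
  have hu : 0 < x first := by linarith
  have hcard : (Finset.Iic j).card = k := by
    rw [Fin.card_Iic, hj]
  have h := esymmOn_ge (τ := τ) hu hδ hδ1 hτ.le
    (fun i => hlo.trans (hx (Fin.le_def.2 (by omega))))
    (fun i => hx (Fin.le_def.2 (by omega))) (Finset.subset_univ (Finset.Iic j))
    (fun i hi => hc.trans (hx (Finset.mem_Iic.1 hi)))
  rw [hcard, Finset.card_univ, Fintype.card_fin, ← sigma_eq_esymmOn, hσ] at h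
  -- The summand 1 in the lower bound on the first entry serves here: powers can only increase it.
  have h1 : x first ≤ x first ^ k := le_self_pow₀ (by linarith) (by omega)
  have h2 : τ ^ k / 2 * x first ≤ (τ ^ k - 2 ^ n * δ) * x first ^ k :=
    mul_le_mul (by linarith) h1 hu.le (by linarith)
  have h3 : τ ^ k / 2 * (1 + 2 * s / τ ^ k) = τ ^ k / 2 + s := by
    field_simp
  have h4 : τ ^ k / 2 * (1 + 2 * s / τ ^ k) ≤ τ ^ k / 2 * x first :=
    mul_le_mul_of_nonneg_left hbig (by positivity)
  linarith

theorem lemma3p1 (n k : ℕ) (hk : 1 ≤ k) (hkn : k ≤ n) :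
    ∃ δ₀ : ℝ, 0 < δ₀ ∧ δ₀ < 1 ∧
      ∀ s : ℝ, 0 < s → ∃ Λ : ℝ, 0 < Λ ∧
        ∀ δ : ℝ, 0 < δ → δ ≤ δ₀ →
        ∀ lam : Fin n → ℝ, lam ∈ gardingCone n k → Antitone lam → sigma n k lam = s →
          ∀ first last : Fin n, (first : ℕ) = 0 → (last : ℕ) + 1 = n →
            -δ * lam first ≤ lam last → Λ ≤ lam first →
            ∀ ξ : Fin n → ℝ,
              (1 + 1 / (1 + 16 * (k : ℝ))) *
                  (sigmaD n k first lam * ξ first ^ 2 / (lam first * sigma n k lam))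
                ≤ -(∑ p : Fin n, ∑ q ∈ Finset.univ.erase p,
                      sigmaDD n k p q lam * ξ p * ξ q / sigma n k lam)
                  + 2 * ((∑ i : Fin n, sigmaD n k i lam * ξ i) ^ 2 / sigma n k lam ^ 2)
                  + 2 * ∑ i ∈ Finset.Ioi first,
                      sigmaD n k i lam * ξ i ^ 2 / ((1 + 2 * δ) * lam first * sigma n k lam) := by
  -- Made total in Θ and k so that θ becomes a function φ of Θ that can be iterated.
  have hφ : ∀ Θ : ℝ, ∃ θ : ℝ, 0 < Θ → 0 < θ ∧ θ ≤ Θ ∧ (2 ≤ k →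
      ∀ (x ξ : Fin n → ℝ) (S L : Finset (Fin n)) (i : Fin n) (u δ : ℝ),
      S.card ≤ n → i ∈ S → x i = u → 0 < u → L ⊆ S.erase i → L.card ≤ k - 2 →
      InCone x S (k - 2 + 2) → (∀ j ∈ S, x j ≤ u) → (∀ j ∈ L, Θ * u ≤ x j) →
      (∀ j ∈ S.erase i, j ∉ L → x j ≤ θ * u) → 0 ≤ δ → δ ≤ 1 / 20 →
      (1 + 1 / (1 + 16 * (((k - 2 : ℕ) : ℝ) + 2)))
          * (esymmOn x (S.erase i) (k - 2 + 1) * ξ i ^ 2 / (u * esymmOn x S (k - 2 + 2)))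
        ≤ -(esymmOnDD x ξ S (k - 2 + 2) / esymmOn x S (k - 2 + 2))
          + 2 * (esymmOnD x ξ S (k - 2 + 2) ^ 2 / esymmOn x S (k - 2 + 2) ^ 2)
          + 2 * ∑ j ∈ S.erase i, esymmOn x (S.erase j) (k - 2 + 1) * ξ j ^ 2
            / ((1 + 2 * δ) * u * esymmOn x S (k - 2 + 2))) := by
    intro Θ
    by_cases hΘ : 0 < Θ
    · by_cases hk2 : 2 ≤ k
      · obtain ⟨θ, h1, h2, h3⟩ := exists_threshold (ι := Fin n) (N := n) (m := k - 2) (by omega) hΘ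
        exact ⟨θ, fun _ => ⟨h1, h2, fun _ => h3⟩⟩
      · exact ⟨Θ, fun _ => ⟨hΘ, le_rfl, fun h => absurd h hk2⟩⟩
    · exact ⟨0, fun h => absurd h hΘ⟩
  choose φ hφ using hφ
  set Θ : ℕ → ℝ := fun p => φ^[p] 1 with hΘ
  have hΘs : ∀ p, Θ (p + 1) = φ (Θ p) := fun p => Function.iterate_succ_apply' φ p 1
  have hΘ0 : ∀ p, 0 < Θ p := by
    intro p
    induction p with
    | zero => exact one_pos
    | succ p ih => rw [hΘs]; exact (hφ _ ih).1
  have hΘa : Antitone Θ := antitone_nat_of_succ_le fun p => by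
    rw [hΘs]; exact (hφ _ (hΘ0 p)).2.1
  set τ := Θ (k - 1) with hτ
  have hτ0 : 0 < τ := hΘ0 _
  refine ⟨min (1 / 20) (τ ^ k / 2 / 2 ^ n), lt_min (by norm_num) (by positivity),
    (min_le_left _ _).trans_lt (by norm_num), fun s hs => ⟨1 + 2 * s / τ ^ k, by positivity, ?_⟩⟩
  intro δ hδ hδ0 x hx hanti hσ first last hfirst hlast hlo hbig ξ
  have hδ20 : δ ≤ 1 / 20 := hδ0.trans (min_le_left _ _)
  have hδτ : 2 ^ n * δ ≤ τ ^ k / 2 := by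
    have := hδ0.trans (min_le_right _ _)
    rw [le_div_iff₀ (by positivity)] at this
    linarith
  have hu : 0 < x first := by
    have : 0 < 2 * s / τ ^ k := by positivity
    linarith
  have hk1 : k - 1 < n := by omega
  have hend := entry_lt_of_sigma_eq hk hτ0 hs hδ.le (by linarith) hδτ hanti hσ
    (j := ⟨k - 1, hk1⟩) hfirst hlast hlo hbig (by simp; omega)
  -- For k = 1 the threshold is Θ_0 = 1 and the entry in question is the first one, so no such
  -- vector exists.
  have hk2 : 2 ≤ k := by
    by_contra! hk2
    obtain rfl : k = 1 := by omega
    have h1 : (⟨1 - 1, hk1⟩ : Fin n) = first := Fin.ext (by simp [hfirst])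
    have h2 : τ = 1 := rfl
    rw [h1, h2] at hend
    linarith
  -- Indices start at 0. For the least such l = p + 1, entries 1, …, p are at least Θ_p times the
  -- first and all later ones at most Θ_{p+1} = φ(Θ_p) times it. Here p ≤ k − 2, as the threshold
  -- lemma requires.
  have hex : ∃ l, ∃ hl : l < n, 1 ≤ l ∧ x ⟨l, hl⟩ < Θ l * x first := ⟨k - 1, hk1, by omega, hend⟩
  classical
  obtain ⟨hln, hl1, hlt⟩ := Nat.find_spec hex
  have hmin := fun p (hp : p < Nat.find hex) => Nat.find_min hex hp
  have hlk : Nat.find hex ≤ k - 1 := Nat.find_min' hex ⟨hk1, by omega, hend⟩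
  generalize Nat.find hex = l at *
  obtain ⟨p, rfl⟩ : ∃ p, l = p + 1 := ⟨l - 1, by omega⟩
  set L : Finset (Fin n) := Finset.Ioo first ⟨p + 1, hln⟩ with hL
  have hmain := (hφ (Θ p) (hΘ0 p)).2.2 hk2 x ξ Finset.univ L first (x first) δ (by simp)
    (Finset.mem_univ _) rfl hu
    (fun j hj => Finset.mem_erase.2 ⟨(Finset.mem_Ioo.1 hj).1.ne', Finset.mem_univ j⟩)
    (by rw [hL, Fin.card_Ioo, hfirst]; simp only; omega)
    (fun j hj => by
      rcases Nat.eq_zero_or_pos j with rfl | hj0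
      · simp
      · rw [← sigma_eq_esymmOn]
        exact hx j hj0 (by omega))
    (fun j _ => hanti (Fin.le_def.2 (by omega)))
    (fun j hj => by
      obtain ⟨h1, h2⟩ := Finset.mem_Ioo.1 hj
      rw [Fin.lt_def] at h1 h2
      have h3 := hmin j h2
      push Not at h3
      have h4 := h3 j.2 (by omega)
      have h5 : Θ p ≤ Θ j := hΘa (Nat.lt_succ_iff.1 h2)
      exact (mul_le_mul_of_nonneg_right h5 hu.le).trans h4)
    (fun j hj hjL => by
      rw [← hΘs]
      refine le_trans (hanti ?_) hlt.le
      have h1 := Finset.ne_of_mem_erase hj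
      by_contra! h2
      refine hjL (Finset.mem_Ioo.2 ⟨lt_of_le_of_ne (Fin.le_def.2 (by omega)) h1.symm, h2⟩))
    hδ.le hδ20
  obtain ⟨m, rfl⟩ : ∃ m, k = m + 2 := ⟨k - 2, by omega⟩
  have hIoi : Finset.Ioi first = Finset.univ.erase first := by
    ext j
    simp only [Finset.mem_Ioi, Finset.mem_erase, Finset.mem_univ, and_true]
    exact ⟨fun h => h.ne', fun h => lt_of_le_of_ne (Fin.le_def.2 (by omega)) h.symm⟩
  have hD : ∑ i : Fin n, sigmaD n (m + 2) i x * ξ i = esymmOnD x ξ Finset.univ (m + 2) := by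
    rw [esymmOnD_succ']
    exact Finset.sum_congr rfl fun i _ => by rw [sigmaD_eq_esymmOn, mul_comm]
  have hDD : ∑ p : Fin n, ∑ q ∈ Finset.univ.erase p,
      sigmaDD n (m + 2) p q x * ξ p * ξ q / sigma n (m + 2) x
      = esymmOnDD x ξ Finset.univ (m + 2) / esymmOn x Finset.univ (m + 2) := by
    rw [esymmOnDD_succ', Finset.sum_div]
    refine Finset.sum_congr rfl fun i _ => ?_
    rw [esymmOnD_succ', Finset.mul_sum, Finset.sum_div]
    refine Finset.sum_congr rfl fun j hj => ?_
    rw [sigmaDD_eq_esymmOn n m (Finset.ne_of_mem_erase hj), sigma_eq_esymmOn]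
    ring
  rw [hDD, hD, hIoi]
  simp only [sigmaD_eq_esymmOn, sigma_eq_esymmOn]
  simpa using hmain

end Conclusion
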